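/- **Notation.** For $f\in L^2(\mathbb R)$ let $(\mathsf Ff)(z)=\int_{\mathbb R} f(x)e^{izx}\,dx$, $F^\sharp(z)=\overline{F(\bar z)}$, and let $\mathsf P_t$ be multiplication by $\mathbf 1_{(-\infty,t)}$. Let $U^1_{\rm loc}(\mathbb R)$ be the set of measurable $u:\mathbb R\to\mathbb C$ with $|u|=1$ a.e. such that (U1) after modification on a null set, $u(0)\ne0$ and $|u(z)-u(0)|\le C|z|^\alpha$ near $0$ for some $1/2<\alpha\le1$; (U2) $u$ is a.e. the non-tangential limit, from both half-planes, of a meromorphic function on $D\setminus\mathbb R$ for some domain $D\supset\mathbb R$ with $\overline D=D$. For such $u$ let $\mathsf K=\mathsf F^{-1}\mathsf M_u\mathsf J^\sharp\mathsf F$ on $L^2(\mathbb R)$, i.e. $(\mathsf F\mathsf Kf)(z)=u(z)\overline{(\mathsf Ff)(z)}$ for real $z$, and $\mathsf K[t]=\mathsf P_t\mathsf K\mathsf P_t$ on $L^2(-\infty,t)$. For $f\in L^2(\mathbb R)+\mathbb C\,\mathsf P_t1$ let $\mathsf Kf$ be the limit of $\mathsf K(e^{-\varepsilon|x|}f)$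 in $S'(\mathbb R)$ as $\varepsilon\to0^+$; it is a locally integrable function, and this agrees with $\mathsf K$ on $L^2(\mathbb R)$. When $\|\mathsf K[t]\|_{\rm op}<1$, let $\varphi,\psi\in L^2(-\infty,t)$ solve $(1+\mathsf K[t])\varphi=-\mathsf K[t]1$ and $(1-\mathsf K[t])\psi=\mathsf K[t]1$, and put $\Phi=1-\mathsf K(\varphi+\mathsf P_t1)$, $\Psi=1+\mathsf K(\psi+\mathsf P_t1)$, and $$\tilde A(t,z)=-\tfrac{iz}{2}\,(\mathsf F(1-\mathsf P_t)\Psi)(z),\qquad -i\tilde B(t,z)=-\tfrac{iz}{2}\,(\mathsf F(1-\mathsf P_t)\Phi)(z),$$ as tempered distributions on $\mathbb R$ and as holomorphic functions (given by the Fourier integral) on $\mathbb C_+=\{\Im z>0\}$. Let $\mathcal V_t(u)$ be the space of $f\in L^2(\mathbb R)$ such that $f$ and $\mathsf Kf$ are supported in $[t,\infty)$. An inner function $\theta$ is a bounded holomorphic function on $\mathbb C_+$ with $\lim_{y\to0+}|\theta(x+iy)|=1$ for a.e. $x\in\mathbb R$; it is extended meromorphically to $\mathbb C_-=\{\Im z<0\}$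 by $\theta=1/\theta^\sharp$. Put $\mathcal K(\theta)=H^2(\mathbb C_+)\ominus\theta H^2(\mathbb C_+)$. **Theorem 2.5.** Let $u\in U^1_{\rm loc}(\mathbb R)$ be the non-tangential boundary value a.e. on $\mathbb R$ of an inner function $\theta$ in $\mathbb C_+$. Then $\|\mathsf K[0]\|_{\rm op}<1$, $\Phi$ and $\Psi$ exist for $t=0$, the Fourier integrals defining $\tilde A(0,z)$ and $\tilde B(0,z)$ converge absolutely on $\mathbb C_+$, and $$\tilde A(0,z)=\tfrac12(1+\theta(z)),\qquad -i\tilde B(0,z)=\tfrac12(1-\theta(z)).$$ These equalities hold for every $z\in\mathbb C_+$; on $\mathbb R$ as tempered distributions, with $u$ in place of $\theta$; and for every $z\in\mathbb C_-$ that is not a pole of $\theta$, where $\tilde A(0,\cdot)$ and $\tilde B(0,\cdot)$ are continued to $\mathbb C_-$ by the functional equations $\tilde A=\theta\tilde A^\sharp$ and $\tilde B=\theta\tilde B^\sharp$. Moreover, $\mathsf F(\mathcal V_0(u))=\mathcal K(\theta)$ as spaces of functions on $\mathbb C_+$. -/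

import Mathlib

open MeasureTheory Filter Topology Set
open scoped FourierTransform SchwartzMap ComplexConjugate ENNReal

noncomputable section

namespace LacunaryModel

/-- The Hilbert space `L²(ℝ)` of complex-valued functions. -/
abbrev L2 : Type := Lp ℂ 2 (volume : Measure ℝ)

/-- The open upper half-plane `ℂ₊`. -/
def Cplus : Set ℂ := {z | 0 < z.im}

/-- The real line as a subset of `ℂ`. -/
def realLine : Set ℂ := {z | z.im = 0}

/-! ### Unimodular functions and inner functions -/

/-- A unimodular function on `ℝ`: measurable with `|u| = 1` almost everywhere
(so `u` is automatically locally integrable). -/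
structure IsUnimodular (u : ℝ → ℂ) : Prop where
  aestronglyMeasurable : AEStronglyMeasurable u volume
  norm_eq_one : ∀ᵐ x : ℝ, ‖u x‖ = 1

/-- The non-tangential limit of `F` at the real point `x`, from the upper half-plane, is `c`. -/
def NTLimUpper (F : ℂ → ℂ) (x : ℝ) (c : ℂ) : Prop :=
  ∀ a : ℝ, 0 < a → Tendsto F (𝓝[{z : ℂ | 0 < z.im ∧ |z.re - x| ≤ a * z.im}] (x : ℂ)) (𝓝 c)

/-- The non-tangential limit of `F` at the real point `x`, from the lower half-plane, is `c`. -/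
def NTLimLower (F : ℂ → ℂ) (x : ℝ) (c : ℂ) : Prop :=
  ∀ a : ℝ, 0 < a → Tendsto F (𝓝[{z : ℂ | z.im < 0 ∧ |z.re - x| ≤ a * (-z.im)}] (x : ℂ)) (𝓝 c)

/-- After modification on a null set, `u` has a nonzero value `u₀` at `0` and is Hölder continuous
there with an exponent `1/2 < α ≤ 1`. -/
def HolderAtZero (u : ℝ → ℂ) : Prop :=
  ∃ u₀ : ℂ, u₀ ≠ 0 ∧ ∃ α : ℝ, 1 / 2 < α ∧ α ≤ 1 ∧ ∃ C δ : ℝ, 0 < δ ∧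
    ∀ᵐ x : ℝ, |x| < δ → ‖u x - u₀‖ ≤ C * |x| ^ α

/-- `u` is, almost everywhere, the non-tangential limit from both half-planes of a meromorphic
function on `D \ ℝ`, where `D` is a domain containing `ℝ` and symmetric under conjugation. -/
def HasMeromorphicExtension (u : ℝ → ℂ) : Prop :=
  ∃ D : Set ℂ, IsOpen D ∧ IsConnected D ∧ realLine ⊆ D ∧ (∀ z ∈ D, conj z ∈ D) ∧
    ∃ U : ℂ → ℂ, MeromorphicOn U (D \ realLine) ∧
      ∀ᵐ x : ℝ, NTLimUpper U x (u x) ∧ NTLimLower U x (u x)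

/-- The class `U¹_loc(ℝ)`. -/
structure MemU1loc (u : ℝ → ℂ) : Prop extends IsUnimodular u where
  holder : HolderAtZero u
  extension : HasMeromorphicExtension u

/-- `θ` is an inner function in `ℂ₊`. -/
structure IsInner (θ : ℂ → ℂ) : Prop where
  differentiableOn : DifferentiableOn ℂ θ Cplus
  bounded : ∃ C : ℝ, ∀ z ∈ Cplus, ‖θ z‖ ≤ C
  norm_boundary : ∀ᵐ x : ℝ,
    Tendsto (fun y : ℝ => ‖θ ((x : ℂ) + (y : ℂ) * Complex.I)‖) (𝓝[>] 0) (𝓝 1)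

/-- The extension of an inner function to `ℂ₋` by `θ(z) = 1 / conj (θ (conj z))`. -/
def innerExt (θ : ℂ → ℂ) (z : ℂ) : ℂ :=
  if 0 < z.im then θ z else 1 / conj (θ (conj z))

/-- `u` is the restriction of `θ` to the real line (by non-tangential limits from `ℂ₊`). -/
def IsBoundaryValue (u : ℝ → ℂ) (θ : ℂ → ℂ) : Prop :=
  ∀ᵐ x : ℝ, NTLimUpper θ x (u x)

/-! ### The antilinear operator `K` on `L²(ℝ)` -/

theorem quasiMeasurePreserving_mul {c : ℝ} (hc : c ≠ 0) :
    Measure.QuasiMeasurePreserving (fun x : ℝ => c * x) volume volume := by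
  refine ⟨measurable_const_mul c, ?_⟩
  rw [Real.map_volume_mul_left hc]
  exact Measure.smul_absolutelyContinuous

theorem memLp_mul_conj {u : ℝ → ℂ} (hu : IsUnimodular u) (g : L2) :
    MemLp (fun ξ : ℝ => u (-(2 * Real.pi) * ξ) * conj (g ξ)) 2 volume := by
  have hq := quasiMeasurePreserving_mul (c := -(2 * Real.pi)) (by simp [Real.pi_ne_zero])
  refine (Lp.memLp g).of_le ?_ ?_
  · refine (hu.aestronglyMeasurable.comp_quasiMeasurePreserving hq).mul ?_
    exact Complex.continuous_conj.comp_aestronglyMeasurable (Lp.aestronglyMeasurable g)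
  · filter_upwards [hq.ae hu.norm_eq_one] with x hx
    simp only [norm_mul, RCLike.norm_conj]
    rw [hx, one_mul]

/-- The operator `K = F⁻¹ M_u J^♯ F` on `L²(ℝ)`, where `(F f)(z) = ∫ f(x) e^{izx} dx` and
`(J^♯ G)(z) = conj (G z)` for real `z`. In terms of Mathlib's Fourier transform `𝓕` one has
`(F f)(z) = (𝓕 f)(-z / (2π))`, so that `(F K f)(z) = u(z) conj ((F f)(z))` reads
`(𝓕 (K f))(ξ) = u(-2πξ) conj ((𝓕 f)(ξ))`. -/
def K {u : ℝ → ℂ} (hu : IsUnimodular u) (f : L2) : L2 :=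
  𝓕⁻ ((memLp_mul_conj hu (𝓕 f)).toLp _)

/-- The defining relation `(F K f)(z) = u(z) conj ((F f)(z))`. -/
theorem fourier_K {u : ℝ → ℂ} (hu : IsUnimodular u) (f : L2) :
    ∀ᵐ z : ℝ, (𝓕 (K hu f) : L2) (-(2 * Real.pi)⁻¹ * z) =
      u z * conj ((𝓕 f : L2) (-(2 * Real.pi)⁻¹ * z)) := by
  have hq := quasiMeasurePreserving_mul (c := -(2 * Real.pi)⁻¹) (by simp [Real.pi_ne_zero])
  have h1 : (𝓕 (K hu f) : L2) = (memLp_mul_conj hu (𝓕 f)).toLp _ :=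
    FourierTransform.fourier_fourierInv_eq _
  rw [h1]
  filter_upwards [hq.ae (memLp_mul_conj hu (𝓕 f)).coeFn_toLp] with z hz
  rw [hz]
  congr 2
  field_simp

/-- The orthogonal projection `P_t` of `L²(ℝ)` onto `L²(-∞, t)`. -/
def P (t : ℝ) (f : L2) : L2 :=
  ((Lp.memLp f).indicator (measurableSet_Iio (a := t))).toLp _

/-- `‖K[t]‖_op < 1` for the compression `K[t] = P_t K P_t`. -/
def NormCompressionLtOne {u : ℝ → ℂ} (hu : IsUnimodular u) (t : ℝ) : Prop :=
  ∃ c : ℝ, c < 1 ∧ ∀ f : L2, ‖P t (K hu (P t f))‖ ≤ c * ‖f‖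

/-- The extension of `K = F⁻¹ M_u J^♯ F` to functions `S` that define tempered distributions:
`T = K S`, where `T` is a function defining a tempered distribution. If `S` is not in `L²(ℝ)`, the
product of `u` with the tempered distribution `J^♯ F S` is taken as the limit in `𝓢'(ℝ)`, as
`ε → 0+`, of the products of `u` with the convolutions of `J^♯ F S` and the Poisson kernel
`ε / (π (z² + ε²))`. Since this convolution is `J^♯ F` applied to `e^{-ε|x|} S(x)`, which has to be
in `L²(ℝ)`, this says that `T` is the limit in `𝓢'(ℝ)` of `K (e^{-ε|x|} S)`. -/
def IsExtK {u : ℝ → ℂ} (hu : IsUnimodular u) (S T : ℝ → ℂ) : Prop :=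
  (∀ g : 𝓢(ℝ, ℂ), Integrable (fun x => T x * g x)) ∧
  ∃ s : ℝ → L2, (∀ ε > 0, s ε =ᵐ[volume] fun x => (Real.exp (-ε * |x|) : ℂ) * S x) ∧
    ∀ g : 𝓢(ℝ, ℂ),
      Tendsto (fun ε : ℝ => ∫ x, K hu (s ε) x * g x) (𝓝[>] 0) (𝓝 (∫ x, T x * g x))

/-- The function `P_t 1`. -/
def Pone (t : ℝ) : ℝ → ℂ := (Iio t).indicator 1

/-- `Φ = Φ(t, ·)`: there is `φ ∈ L²(-∞, t)` with `(1 + K[t]) φ = -K[t] 1`, and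
`Φ = 1 - K (φ + P_t 1)`. -/
def IsPhi {u : ℝ → ℂ} (hu : IsUnimodular u) (t : ℝ) (Φ : ℝ → ℂ) : Prop :=
  ∃ φ : L2, (∀ᵐ x : ℝ, t < x → φ x = 0) ∧
    (∃ κ : ℝ → ℂ, IsExtK hu (Pone t) κ ∧
      ∀ᵐ x : ℝ, x < t → φ x + K hu φ x = -κ x) ∧
    ∃ T : ℝ → ℂ, IsExtK hu (fun x => φ x + Pone t x) T ∧ ∀ᵐ x : ℝ, Φ x = 1 - T x

/-- `Ψ = Ψ(t, ·)`: there is `ψ ∈ L²(-∞, t)` with `(1 - K[t]) ψ = K[t] 1`, and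
`Ψ = 1 + K (ψ + P_t 1)`. -/
def IsPsi {u : ℝ → ℂ} (hu : IsUnimodular u) (t : ℝ) (Ψ : ℝ → ℂ) : Prop :=
  ∃ ψ : L2, (∀ᵐ x : ℝ, t < x → ψ x = 0) ∧
    (∃ κ : ℝ → ℂ, IsExtK hu (Pone t) κ ∧
      ∀ᵐ x : ℝ, x < t → ψ x - K hu ψ x = κ x) ∧
    ∃ T : ℝ → ℂ, IsExtK hu (fun x => ψ x + Pone t x) T ∧ ∀ᵐ x : ℝ, Ψ x = 1 + T x

/-! ### The functions `Ã(t, z)` and `B̃(t, z)` -/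

/-- `-(iz/2) (F (1 - P_t) X)(z)` as a tempered distribution in `z ∈ ℝ`, evaluated at the test
function `g`; here `(F f, g) = (f, F g)` and `(m f, g) = (f, m g)`. -/
def halfDist (X : ℝ → ℂ) (t : ℝ) (g : 𝓢(ℝ, ℂ)) : ℂ :=
  ∫ x in Ioi t, X x * ∫ z : ℝ, (-(Complex.I * z / 2) * g z) * Complex.exp (Complex.I * z * x)

/-- `-(iz/2) (F (1 - P_t) X)(z)` as a function of `z ∈ ℂ₊`. -/
def halfHol (X : ℝ → ℂ) (t : ℝ) (z : ℂ) : ℂ :=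
  -(Complex.I * z / 2) * ∫ x in Ioi t, X x * Complex.exp (Complex.I * z * x)

/-- The continuation of a function `G` on `ℂ₊` to `ℂ₋` by the functional equation
`G = U G^♯`, where `G^♯(z) = conj (G (conj z))`. -/
def continuation (U G : ℂ → ℂ) (z : ℂ) : ℂ :=
  if 0 < z.im then G z else U z * conj (G (conj z))

/-- `Ã(t, ·)` on `ℂ \ ℝ`, formed with `Ψ = Ψ(t, ·)` and the extension `U` of `u` to `ℂ \ ℝ`. -/
def Atilde (U : ℂ → ℂ) (Ψ : ℝ → ℂ) (t : ℝ) : ℂ → ℂ :=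
  continuation U (halfHol Ψ t)

/-- `B̃(t, ·)` on `ℂ \ ℝ`, formed with `Φ = Φ(t, ·)` and the extension `U` of `u` to `ℂ \ ℝ`;
on `ℂ₊` it is given by `-i B̃(t, z) = -(iz/2) (F (1 - P_t) Φ)(z)`. -/
def Btilde (U : ℂ → ℂ) (Φ : ℝ → ℂ) (t : ℝ) : ℂ → ℂ :=
  continuation U (fun z => Complex.I * halfHol Φ t z)

/-- `Ã(t, ·)` as a tempered distribution on `ℝ`. -/
def AtildeDist (Ψ : ℝ → ℂ) (t : ℝ) (g : 𝓢(ℝ, ℂ)) : ℂ := halfDist Ψ t g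

/-- `B̃(t, ·)` as a tempered distribution on `ℝ`. -/
def BtildeDist (Φ : ℝ → ℂ) (t : ℝ) (g : 𝓢(ℝ, ℂ)) : ℂ := Complex.I * halfDist Φ t g

/-! ### The spaces `V_t(u)`, `H²(ℂ₊)` and `K(θ)` -/

/-- `V_t(u)`: the `f ∈ L²(ℝ)` such that both `f` and `K f` are supported in `[t, ∞)`. -/
def V {u : ℝ → ℂ} (hu : IsUnimodular u) (t : ℝ) : Set L2 :=
  {f | (∀ᵐ x : ℝ, x < t → f x = 0) ∧ (∀ᵐ x : ℝ, x < t → K hu f x = 0)}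

/-- `F(V_t(u))` as a space of functions on `ℂ₊`. -/
def fourierV {u : ℝ → ℂ} (hu : IsUnimodular u) (t : ℝ) : Set (Cplus → ℂ) :=
  {F | ∃ f ∈ V hu t, ∀ z : Cplus, F z = ∫ x : ℝ, f x * Complex.exp (Complex.I * (z : ℂ) * x)}

/-- `F` belongs to the Hardy space `H²(ℂ₊)`. -/
def IsHardy (F : ℂ → ℂ) : Prop :=
  DifferentiableOn ℂ F Cplus ∧
    ∃ C : ℝ, ∀ y : ℝ, 0 < y →
      ∫⁻ x : ℝ, ‖F ((x : ℂ) + (y : ℂ) * Complex.I)‖ₑ ^ 2 ≤ ENNReal.ofReal C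

/-- Orthogonality of `F, G ∈ H²(ℂ₊)`. The inner product of `H²(ℂ₊)` is that of the boundary
values in `L²(ℝ)`, which is the limit of `∫ F(x + iy) conj (G(x + iy)) dx` as `y → 0+`. -/
def HardyOrthogonal (F G : ℂ → ℂ) : Prop :=
  Tendsto (fun y : ℝ => ∫ x : ℝ, F ((x : ℂ) + (y : ℂ) * Complex.I) *
    conj (G ((x : ℂ) + (y : ℂ) * Complex.I))) (𝓝[>] 0) (𝓝 0)

/-- The model space `K(θ) = H²(ℂ₊) ⊖ θ H²(ℂ₊)`, as a space of functions on `ℂ₊`. -/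
def modelSpace (θ : ℂ → ℂ) : Set (Cplus → ℂ) :=
  {f | ∃ F : ℂ → ℂ, IsHardy F ∧
    (∀ G : ℂ → ℂ, IsHardy G → HardyOrthogonal F (fun z => θ z * G z)) ∧
    ∀ z : Cplus, f z = F z}

end LacunaryModel

end

noncomputable section

namespace LacunaryModel

/-! ### Tools for `L²(ℝ)` -/

/-! Conjugation on the real line is the Fourier image of the involution f(x) ↦ conj (f(-x)), which
exchanges the two half-lines. So if f lives on (-∞, 0), the conjugate of F f is the boundary value
of a function in H²(ℂ₊), and K multiplies this function by θ. The product is again in H², and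
Paley–Wiener puts K f on (0, ∞). This is `K_of_suppNonneg_conjRefl`. Hence K[0] = 0, the equations
for φ and ψ have only the solution 0, and Φ, Ψ are 1 ∓ K(P₀1).

It remains to compute K(P₀1) (`exists_isExtK_Pone`). The damped function e^{-ε|x|}P₀1 is sent to a
function with transform θ(z)·i/(z + iε), which has no L² limit because of the singularity at 0.
Subtracting u(0)·i/(z + iε) leaves (u - u(0))·i/(z + iε); the Hölder condition with exponent above
1/2 bounds this by one L² function for all ε, so it converges. Therefore K(P₀1) = u(0)·1_{x>0} + h
with F h = (θ - u(0))·i/z. In the half-line transform of 1 ± K(P₀1) the constant u(0) cancels,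
leaving (1 ± θ)·i/z, and the factor -iz/2 gives (1 ± θ)/2. The distributional identity is the same
computation paired with test functions, and the one on ℂ₋ is algebra.

For the model space, let f and g live on (0, ∞) and let k correspond to θ·F g. Then ⟨k, f⟩ = ⟨K f,
conj g(-·)⟩ (`inner_eq_inner_K`). Since conj g(-·) runs through L²(-∞, 0), orthogonality to θH² says
exactly that K f vanishes there.

Paley–Wiener itself is `IsHardy.exists_laplace_eq`: by a contour shift, e^{ys} times the inverse
transform of H on the line Im z = y does not depend on y, and the uniform H² bound as y → ∞ and as y
→ 0 gives support and square integrability. -/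

theorem ae_eq_of_forall_integral_schwartz {S T : ℝ → ℂ} (hS : LocallyIntegrable S)
    (hT : LocallyIntegrable T) (h : ∀ g : 𝓢(ℝ, ℂ), ∫ x, S x * g x = ∫ x, T x * g x) :
    S =ᵐ[volume] T := by
  refine ae_eq_of_integral_contDiff_smul_eq hS hT fun g hg hc => ?_
  have hc' : HasCompactSupport (fun x => (g x : ℂ)) := hc.comp_left (g := Complex.ofReal) (by simp)
  have := h (hc'.toSchwartzMap (Complex.ofRealCLM.contDiff.comp hg))
  have h2 : ∀ x, (hc'.toSchwartzMap (Complex.ofRealCLM.contDiff.comp hg)) x = (g x : ℂ) :=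
    fun x => rfl
  simp only [h2] at this
  simpa [mul_comm, Complex.real_smul] using this

theorem norm_sq_eq_integral (f : L2) : ‖f‖ ^ 2 = ∫ x, ‖f x‖ ^ 2 := by
  have h := L2.inner_def (𝕜 := ℂ) f f
  simp only [inner_self_eq_norm_sq_to_K] at h
  have h2 : ∫ a, ((‖f a‖ : ℂ)) ^ 2 = ((∫ x, ‖f x‖ ^ 2 : ℝ) : ℂ) := by
    rw [← integral_complex_ofReal]
    simp
  rw [← Complex.ofReal_inj, ← h2]
  simpa using h

theorem lintegral_enorm_sq (f : L2) : ∫⁻ x, ‖f x‖ₑ ^ 2 = ENNReal.ofReal (‖f‖ ^ 2) := by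
  have h := eLpNorm_eq_lintegral_rpow_enorm_toReal (f := f) (μ := volume) two_ne_zero
    ENNReal.ofNat_ne_top
  have h2 : ENNReal.ofReal ‖f‖ = eLpNorm f 2 volume := by
    rw [Lp.norm_def, ENNReal.ofReal_toReal (Lp.eLpNorm_ne_top f)]
  rw [ENNReal.ofReal_pow (norm_nonneg _), h2, h]
  rw [← ENNReal.rpow_two (x := _ ^ (1 / _)), ← ENNReal.rpow_mul]
  norm_num

theorem lintegral_enorm_sq_congr {f : L2} {F : ℝ → ℂ} (h : f =ᵐ[volume] F) :
    ∫⁻ x, ‖F x‖ₑ ^ 2 = ENNReal.ofReal (‖f‖ ^ 2) := by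
  rw [← lintegral_enorm_sq]
  exact lintegral_congr_ae (by filter_upwards [h] with x hx; rw [hx])

theorem memLp_two_of_lintegral {F : ℝ → ℂ} (hF : AEStronglyMeasurable F volume)
    (h : ∫⁻ x, ‖F x‖ₑ ^ 2 < ∞) : MemLp F 2 volume := by
  refine ⟨hF, ?_⟩
  rw [eLpNorm_lt_top_iff_lintegral_rpow_enorm_lt_top two_ne_zero ENNReal.ofNat_ne_top]
  simpa using h

/-- Dominated convergence for the squared difference, with majorant (2·bound)². The representatives
`G` are separate from the classes `F` so that pointwise limits can be taken on explicit formulas. -/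
theorem tendsto_L2_of_dominated {ι : Type*} {l : Filter ι} [l.IsCountablyGenerated]
    {F : ι → L2} {f : L2} {G : ι → ℝ → ℂ} {bound : ℝ → ℝ} (hb : MemLp bound 2 volume)
    (hF : ∀ᶠ n in l, F n =ᵐ[volume] G n)
    (h_bound : ∀ᶠ n in l, ∀ᵐ x, ‖G n x‖ ≤ bound x)
    (hf : ∀ᵐ x, ‖f x‖ ≤ bound x)
    (h_lim : ∀ᵐ x, Tendsto (fun n => G n x) l (𝓝 (f x))) : Tendsto F l (𝓝 f) := by
  have key : Tendsto (fun n => ∫ x, ‖G n x - f x‖ ^ 2) l (𝓝 (∫ _ : ℝ, (0 : ℝ))) := by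
    refine tendsto_integral_filter_of_dominated_convergence (fun x => ‖2 * bound x‖ ^ 2) ?_ ?_
      (hb.const_mul (2 : ℝ)).norm.integrable_sq ?_
    · filter_upwards [hF] with n hn
      exact (((Lp.aestronglyMeasurable (F n)).congr hn).sub
        (Lp.aestronglyMeasurable f)).norm.pow 2
    · filter_upwards [h_bound] with n hn
      filter_upwards [hn, hf] with x hx hfx
      rw [norm_pow, norm_norm]
      gcongr
      calc ‖G n x - f x‖ ≤ ‖G n x‖ + ‖f x‖ := norm_sub_le _ _
        _ ≤ 2 * bound x := by linarith
        _ ≤ ‖2 * bound x‖ := Real.le_norm_self _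
    · filter_upwards [h_lim] with x hx
      have h1 := ((hx.sub_const (f x)).norm).pow 2
      simpa using h1
  rw [tendsto_iff_norm_sub_tendsto_zero]
  have h2 : Tendsto (fun n => ‖F n - f‖ ^ 2) l (𝓝 0) := by
    rw [integral_zero] at key
    refine key.congr' ?_
    filter_upwards [hF] with n hn
    rw [norm_sq_eq_integral]
    refine integral_congr_ae ?_
    filter_upwards [hn, Lp.coeFn_sub (F n) f] with x h1 h2
    rw [h2, Pi.sub_apply, h1]
  have h3 := (Real.continuous_sqrt.tendsto _).comp h2
  simpa [Function.comp_def, Real.sqrt_sq (norm_nonneg _)] using h3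

theorem ae_eq_of_tendsto_L2 {ι : Type*} {l : Filter ι} [l.NeBot] [l.IsCountablyGenerated]
    {F : ι → L2} {f : L2} {G : ι → ℝ → ℂ} {g : ℝ → ℂ} (h : Tendsto F l (𝓝 f))
    (hF : ∀ᶠ n in l, F n =ᵐ[volume] G n)
    (h_lim : ∀ᵐ x, Tendsto (fun n => G n x) l (𝓝 (g x))) : f =ᵐ[volume] g := by
  obtain ⟨s, hs⟩ := l.exists_seq_tendsto
  -- Shifting by `N` makes the a.e. identity hold for every index, so countably many null sets can
  -- be discarded at once.
  obtain ⟨N, hN⟩ := eventually_atTop.1 (hs.eventually hF)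
  obtain ⟨ns, hns, hae⟩ :=
    (tendstoInMeasure_of_tendsto_Lp (h.comp (hs.comp (tendsto_add_atTop_nat N)))).exists_seq_tendsto_ae'
  have hall : ∀ᵐ x, ∀ n, F (s (n + N)) x = G (s (n + N)) x :=
    ae_all_iff.2 fun n => hN (n + N) (by omega)
  filter_upwards [hae, hall, h_lim] with x h1 h2 h3
  refine tendsto_nhds_unique h1 ?_
  have h4 := h3.comp (hs.comp ((tendsto_add_atTop_nat N).comp hns))
  refine h4.congr fun n => ?_
  simp [h2]

theorem integrable_mul_schwartz (f : L2) (g : 𝓢(ℝ, ℂ)) : Integrable (fun x => f x * g x) :=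
  (Lp.memLp f).integrable_mul (g.memLp 2 volume)

/-- The pairing is the inner product with conj g, hence continuous. -/
theorem tendsto_integral_mul {ι : Type*} {l : Filter ι} {F : ι → L2} {f : L2}
    (h : Tendsto F l (𝓝 f)) {g : ℝ → ℂ} (hg : MemLp g 2 volume) :
    Tendsto (fun n => ∫ x, F n x * g x) l (𝓝 (∫ x, f x * g x)) := by
  have hg' : MemLp (fun x => conj (g x)) 2 volume := hg.star
  have key : ∀ f : L2, inner ℂ (hg'.toLp _) f = ∫ x, f x * g x := by
    intro f
    rw [L2.inner_def]
    refine integral_congr_ae ?_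
    filter_upwards [hg'.coeFn_toLp] with x hx
    simp [hx]
  simp_rw [← key]
  exact (continuous_const.inner continuous_id).tendsto f |>.comp h

theorem locallyIntegrable_L2 (f : L2) : LocallyIntegrable f volume :=
  (Lp.memLp f).locallyIntegrable (by norm_num)

/-! ### The Fourier transform on `L²(ℝ)` -/

theorem integral_fourier_mul_schwartz (f : L2) (g : 𝓢(ℝ, ℂ)) :
    ∫ x, (𝓕 f : L2) x * g x = ∫ x, f x * (𝓕 g : 𝓢(ℝ, ℂ)) x := by
  have h := congrArg (fun T => T g) (Lp.fourier_toTemperedDistribution_eq f)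
  simp only [TemperedDistribution.fourier_apply, Lp.toTemperedDistribution_apply,
    smul_eq_mul] at h
  simpa [mul_comm] using h.symm

/-- Both transforms satisfy the same duality relation against Schwartz functions; this connects the
abstract L² transform with the explicit integral. -/
theorem fourier_ae_eq_of_integrable {f : ℝ → ℂ} (h2 : MemLp f 2 volume) (h1 : Integrable f) :
    (𝓕 (h2.toLp f) : L2) =ᵐ[volume] 𝓕 f := by
  have hcont : Continuous (𝓕 f) :=
    VectorFourier.fourierIntegral_continuous Real.continuous_fourierChar
      (by exact continuous_inner) h1
  refine ae_eq_of_forall_integral_schwartz (locallyIntegrable_L2 _) hcont.locallyIntegrable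
    fun g => ?_
  rw [integral_fourier_mul_schwartz]
  have h := VectorFourier.integral_fourierIntegral_smul_eq_flip (L := innerₗ ℝ)
    (f := f) (g := g) (μ := volume) (ν := volume) Real.continuous_fourierChar
    (by exact continuous_inner) h1 g.integrable
  rw [flip_innerₗ] at h
  have h3 : ∫ x, (h2.toLp f) x * (𝓕 g : 𝓢(ℝ, ℂ)) x = ∫ x, f x * (𝓕 g : 𝓢(ℝ, ℂ)) x :=
    integral_congr_ae (by filter_upwards [h2.coeFn_toLp] with x hx; rw [hx])
  rw [h3, SchwartzMap.fourier_coe]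
  exact h.symm

theorem fourier_eq_integral_exp (f : ℝ → ℂ) (ξ : ℝ) :
    𝓕 f ξ = ∫ x, f x * Complex.exp (Complex.I * ((-(2 * Real.pi) * ξ : ℝ) : ℂ) * x) := by
  rw [Real.fourier_real_eq_integral_exp_smul]
  refine integral_congr_ae (Eventually.of_forall fun x => ?_)
  simp only [smul_eq_mul]
  rw [mul_comm]
  congr 2
  push_cast
  ring

/-! ### Damping by `e^{-ε|x|}` -/

theorem norm_dampFactor_le {ε : ℝ} (hε : 0 ≤ ε) (x : ℝ) :
    ‖(Real.exp (-ε * |x|) : ℂ)‖ ≤ 1 := by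
  rw [Complex.norm_real, Real.norm_eq_abs, abs_of_pos (Real.exp_pos _), Real.exp_le_one_iff]
  have := mul_nonneg hε (abs_nonneg x)
  linarith

theorem continuous_dampFactor (ε : ℝ) : Continuous fun x : ℝ => (Real.exp (-ε * |x|) : ℂ) := by
  fun_prop

theorem memLp_damp {ε : ℝ} (hε : 0 ≤ ε) {f : ℝ → ℂ} (hf : MemLp f 2 volume) :
    MemLp (fun x => (Real.exp (-ε * |x|) : ℂ) * f x) 2 volume := by
  refine hf.of_le ((continuous_dampFactor ε).aestronglyMeasurable.mul hf.1)
    (Eventually.of_forall fun x => ?_)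
  rw [norm_mul]
  exact mul_le_of_le_one_left (norm_nonneg _) (norm_dampFactor_le hε x)

theorem integrable_exp_neg_mul_abs {ε : ℝ} (hε : 0 < ε) :
    Integrable fun x : ℝ => Real.exp (-ε * |x|) := by
  have h1 : IntegrableOn (fun x : ℝ => Real.exp (-ε * |x|)) (Ioi 0) :=
    (exp_neg_integrableOn_Ioi 0 hε).congr_fun
      (fun x hx => by simp only [abs_of_pos (mem_Ioi.1 hx)]) measurableSet_Ioi
  have h2 : IntegrableOn (fun x : ℝ => Real.exp (-ε * |x|)) (Iic 0) := by
    refine (integrableOn_exp_mul_Iic hε 0).congr_fun (fun x hx => ?_) measurableSet_Iic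
    simp only [abs_of_nonpos (mem_Iic.1 hx)]
    ring_nf
  have := h2.union h1
  rwa [Iic_union_Ioi, integrableOn_univ] at this

theorem memLp_dampFactor {ε : ℝ} (hε : 0 < ε) :
    MemLp (fun x : ℝ => (Real.exp (-ε * |x|) : ℂ)) 2 volume := by
  rw [memLp_two_iff_integrable_sq_norm (continuous_dampFactor ε).aestronglyMeasurable]
  refine (integrable_exp_neg_mul_abs (ε := 2 * ε) (by positivity)).congr
    (Eventually.of_forall fun x => ?_)
  simp only [Complex.norm_real, Real.norm_eq_abs, abs_of_pos (Real.exp_pos _), ← Real.exp_nat_mul]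
  congr 1
  push_cast
  ring

/-- `e^{-ε|x|} f(x)`. The absolute value of `ε` makes this total. -/
def damp (ε : ℝ) (f : L2) : L2 := (memLp_damp (abs_nonneg ε) (Lp.memLp f)).toLp _

theorem damp_ae {ε : ℝ} (hε : 0 ≤ ε) (f : L2) :
    damp ε f =ᵐ[volume] fun x => (Real.exp (-ε * |x|) : ℂ) * f x := by
  have h := (memLp_damp (abs_nonneg ε) (Lp.memLp f)).coeFn_toLp
  simpa only [damp, abs_of_nonneg hε] using h

theorem tendsto_damp (f : L2) : Tendsto (fun ε => damp ε f) (𝓝[>] 0) (𝓝 f) := by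
  have h0 : ∀ᶠ ε : ℝ in 𝓝[>] 0, 0 < ε := self_mem_nhdsWithin
  refine tendsto_L2_of_dominated (G := fun ε x => (Real.exp (-ε * |x|) : ℂ) * f x)
    (Lp.memLp f).norm ?_ ?_ (Eventually.of_forall fun x => le_rfl) ?_
  · filter_upwards [h0] with ε hε using damp_ae hε.le f
  · filter_upwards [h0] with ε hε
    refine Eventually.of_forall fun x => ?_
    rw [norm_mul]
    exact mul_le_of_le_one_left (norm_nonneg _) (norm_dampFactor_le hε.le x)
  · refine Eventually.of_forall fun x => ?_
    have : Continuous fun ε : ℝ => (Real.exp (-ε * |x|) : ℂ) * f x := by fun_prop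
    have := this.tendsto 0
    simp only [neg_zero, zero_mul, Real.exp_zero, Complex.ofReal_one, one_mul] at this
    exact this.mono_left nhdsWithin_le_nhds

theorem norm_damp_le (ε : ℝ) (f : L2) : ‖damp ε f‖ ≤ ‖f‖ := by
  refine Lp.norm_le_norm_of_ae_le ?_
  filter_upwards [(memLp_damp (abs_nonneg ε) (Lp.memLp f)).coeFn_toLp] with x hx
  rw [damp, hx, norm_mul]
  exact mul_le_of_le_one_left (norm_nonneg _) (norm_dampFactor_le (abs_nonneg ε) x)

theorem integrable_damp {ε : ℝ} (hε : 0 < ε) {f : ℝ → ℂ} (hf : MemLp f 2 volume) :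
    Integrable fun x => (Real.exp (-ε * |x|) : ℂ) * f x :=
  (memLp_dampFactor hε).integrable_mul hf

theorem fourier_damp_ae {ε : ℝ} (hε : 0 < ε) (f : L2) :
    (𝓕 (damp ε f) : L2) =ᵐ[volume] 𝓕 fun x => (Real.exp (-ε * |x|) : ℂ) * f x := by
  have := fourier_ae_eq_of_integrable (memLp_damp hε.le (Lp.memLp f))
    (integrable_damp hε (Lp.memLp f))
  rwa [← show damp ε f = _ from
    Lp.ext ((damp_ae hε.le f).trans (MemLp.coeFn_toLp _).symm)] at this

/-! ### The involution `f(x) ↦ conj (f (-x))` -/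

theorem memLp_conj_neg (f : L2) : MemLp (fun x : ℝ => conj (f (-x))) 2 volume :=
  ((Lp.memLp f).comp_measurePreserving (Measure.measurePreserving_neg volume)).star

/-- The involution `f(x) ↦ conj (f (-x))` of `L²(ℝ)`. -/
def conjRefl (f : L2) : L2 := (memLp_conj_neg f).toLp _

theorem conjRefl_ae (f : L2) : conjRefl f =ᵐ[volume] fun x => conj (f (-x)) :=
  (memLp_conj_neg f).coeFn_toLp

theorem conjRefl_conjRefl (f : L2) : conjRefl (conjRefl f) = f := by
  refine Lp.ext ?_
  have h := (Measure.measurePreserving_neg (volume : Measure ℝ)).quasiMeasurePreserving.ae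
    (conjRefl_ae f)
  filter_upwards [conjRefl_ae (conjRefl f), h] with x h1 h2
  rw [h1, h2]
  simp

/-- For damped functions this is the substitution x ↦ -x in an absolutely convergent integral; the
general case follows by letting the damping tend to 0. -/
theorem fourier_conjRefl (f : L2) :
    (𝓕 (conjRefl f) : L2) =ᵐ[volume] fun ξ => conj ((𝓕 f : L2) ξ) := by
  have h0 : ∀ᶠ ε : ℝ in 𝓝[>] 0, 0 < ε := self_mem_nhdsWithin
  have hF : Tendsto (fun ε => (𝓕 (damp ε f) : L2)) (𝓝[>] 0) (𝓝 (𝓕 f)) :=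
    ((FourierTransform.continuous_fourier (E := L2)).tendsto f).comp (tendsto_damp f)
  have hG : Tendsto (fun ε => (𝓕 (damp ε (conjRefl f)) : L2)) (𝓝[>] 0) (𝓝 (𝓕 (conjRefl f))) :=
    ((FourierTransform.continuous_fourier (E := L2)).tendsto _).comp (tendsto_damp _)
  have hae : ∀ ε : ℝ, 0 < ε → (𝓕 (damp ε (conjRefl f)) : L2) =ᵐ[volume]
      fun ξ => conj ((𝓕 (damp ε f) : L2) ξ) := by
    intro ε hε
    filter_upwards [fourier_damp_ae hε f, fourier_damp_ae hε (conjRefl f)] with ξ h1 h2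
    rw [h1, h2, fourier_eq_integral_exp, fourier_eq_integral_exp, ← integral_conj,
      ← integral_neg_eq_self]
    refine integral_congr_ae ?_
    have h := (Measure.measurePreserving_neg (volume : Measure ℝ)).quasiMeasurePreserving.ae
      (conjRefl_ae f)
    filter_upwards [h] with x hx
    rw [hx]
    simp [← Complex.exp_conj, Complex.conj_ofNat]
  -- L² convergence gives a.e. convergence only along a subsequence; along it the right-hand side
  -- can be conjugated pointwise.
  obtain ⟨s, hs⟩ := (𝓝[>] (0 : ℝ)).exists_seq_tendsto
  obtain ⟨t, ht, hst⟩ :=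
    (tendstoInMeasure_of_tendsto_Lp (hF.comp hs)).exists_seq_tendsto_ae'
  refine ae_eq_of_tendsto_L2 (hG.comp (hs.comp ht)) (G := fun n ξ =>
    conj ((𝓕 (damp (s (t n)) f) : L2) ξ)) ?_ ?_
  · exact ((hs.comp ht).eventually h0).mono fun n hn => hae _ hn
  · filter_upwards [hst] with x hx
    exact (Complex.continuous_conj.tendsto _).comp hx

/-! ### The Fourier integral on the upper half-plane -/

/-- `f` vanishes on `(-∞, 0)`. -/
def SuppNonneg (f : L2) : Prop := ∀ᵐ x : ℝ, x < 0 → f x = 0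

/-- The Fourier integral `∫ f(x) e^{izx} dx`. -/
def laplace (f : ℝ → ℂ) (z : ℂ) : ℂ := ∫ x, f x * Complex.exp (Complex.I * z * x)

/-- The kernel of the Fourier integral over `(0, ∞)`. -/
def halfKernel (z : ℂ) : ℝ → ℂ := (Ioi 0).indicator fun x : ℝ => Complex.exp (Complex.I * z * x)

/-- The point of the line `Im z = y` over `-2πξ`. -/
def linePt (y ξ : ℝ) : ℂ := ((-(2 * Real.pi) * ξ : ℝ) : ℂ) + (y : ℂ) * Complex.I

@[simp] theorem linePt_im (y ξ : ℝ) : (linePt y ξ).im = y := by simp [linePt]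

theorem continuous_linePt (y : ℝ) : Continuous (linePt y) := by unfold linePt; fun_prop

theorem norm_exp_I_mul (z : ℂ) (x : ℝ) :
    ‖Complex.exp (Complex.I * z * x)‖ = Real.exp (-z.im * x) := by
  rw [Complex.norm_exp]
  simp

theorem norm_halfKernel_le (z : ℂ) (x : ℝ) :
    ‖halfKernel z x‖ ≤ ‖(Real.exp (-z.im * |x|) : ℂ)‖ := by
  unfold halfKernel
  by_cases hx : x ∈ Ioi (0 : ℝ)
  · rw [indicator_of_mem hx, norm_exp_I_mul, abs_of_pos (mem_Ioi.1 hx), Complex.norm_real]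
    exact Real.le_norm_self _
  · rw [indicator_of_notMem hx, norm_zero]
    positivity

theorem aestronglyMeasurable_halfKernel (z : ℂ) :
    AEStronglyMeasurable (halfKernel z) volume := by
  refine AEStronglyMeasurable.indicator ?_ measurableSet_Ioi
  exact (by fun_prop : Continuous fun x : ℝ => Complex.exp (Complex.I * z * x)).aestronglyMeasurable

theorem memLp_halfKernel {z : ℂ} (hz : 0 < z.im) : MemLp (halfKernel z) 2 volume :=
  (memLp_dampFactor hz).of_le (aestronglyMeasurable_halfKernel z)
    (Eventually.of_forall (norm_halfKernel_le z))

/-- For Im z > 0 the exponential grows on the negative half-line, while the truncated kernel is in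
L²; the Fourier integral thus becomes an L² pairing. -/
theorem SuppNonneg.mul_exp_ae {f : L2} (hf : SuppNonneg f) (z : ℂ) :
    (fun x : ℝ => f x * Complex.exp (Complex.I * z * x)) =ᵐ[volume]
      fun x => f x * halfKernel z x := by
  filter_upwards [hf, (volume : Measure ℝ).ae_ne 0] with x hx h0
  rcases lt_or_gt_of_ne h0 with h | h
  · simp [hx h]
  · simp [halfKernel, h]

theorem SuppNonneg.laplace_eq {f : L2} (hf : SuppNonneg f) (z : ℂ) :
    laplace f z = ∫ x, f x * halfKernel z x :=
  integral_congr_ae (hf.mul_exp_ae z)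

theorem SuppNonneg.integrable_mul_exp {f : L2} (hf : SuppNonneg f) {z : ℂ} (hz : 0 < z.im) :
    Integrable fun x : ℝ => f x * Complex.exp (Complex.I * z * x) :=
  ((Lp.memLp f).integrable_mul (memLp_halfKernel hz)).congr (hf.mul_exp_ae z).symm

theorem tendsto_laplace {ι : Type*} {l : Filter ι} {F : ι → L2} {f : L2}
    (h : Tendsto F l (𝓝 f)) (hF : ∀ᶠ n in l, SuppNonneg (F n)) (hf : SuppNonneg f)
    {z : ℂ} (hz : 0 < z.im) : Tendsto (fun n => laplace (F n) z) l (𝓝 (laplace f z)) := by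
  rw [hf.laplace_eq]
  refine (tendsto_integral_mul h (memLp_halfKernel hz)).congr' ?_
  filter_upwards [hF] with n hn using (hn.laplace_eq z).symm

theorem suppNonneg_of_tendsto {ι : Type*} {l : Filter ι} [l.NeBot] [l.IsCountablyGenerated]
    {F : ι → L2} {f : L2} (h : Tendsto F l (𝓝 f)) (hF : ∀ᶠ n in l, SuppNonneg (F n)) :
    SuppNonneg f := by
  obtain ⟨s, hs⟩ := l.exists_seq_tendsto
  obtain ⟨N, hN⟩ := eventually_atTop.1 (hs.eventually hF)
  obtain ⟨ns, -, hae⟩ := (tendstoInMeasure_of_tendsto_Lp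
    (h.comp (hs.comp (tendsto_add_atTop_nat N)))).exists_seq_tendsto_ae'
  have hall : ∀ᵐ x, ∀ n, x < 0 → F (s (n + N)) x = 0 :=
    ae_all_iff.2 fun n => hN (n + N) (by omega)
  filter_upwards [hae, hall] with x h1 h2 hx
  refine tendsto_nhds_unique h1 (tendsto_const_nhds.congr fun n => ?_)
  simp [h2 _ hx]

/-- On the support |x| = x, so damping by e^{-y|x|} is the same as moving the evaluation point up to
the line Im z = y. -/
theorem fourier_damp_eq_laplace {f : L2} (hf : SuppNonneg f) {y : ℝ} (hy : 0 < y) :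
    (𝓕 (damp y f) : L2) =ᵐ[volume] fun ξ => laplace f (linePt y ξ) := by
  filter_upwards [fourier_damp_ae hy f] with ξ hξ
  rw [hξ, fourier_eq_integral_exp]
  refine integral_congr_ae ?_
  filter_upwards [hf] with x hx
  rcases lt_or_ge x 0 with h | h
  · simp [hx h]
  · have : Complex.exp (Complex.I * linePt y ξ * x) = (Real.exp (-y * |x|) : ℂ) *
        Complex.exp (Complex.I * ((-(2 * Real.pi) * ξ : ℝ) : ℂ) * x) := by
      rw [Complex.ofReal_exp, ← Complex.exp_add, abs_of_nonneg h, linePt]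
      congr 1
      push_cast
      linear_combination (y : ℂ) * x * Complex.I_sq
    rw [this, mul_left_comm, mul_assoc]

theorem hasDerivAt_halfKernel (z : ℂ) (x : ℝ) :
    HasDerivAt (fun z => halfKernel z x) (Complex.I * x * halfKernel z x) z := by
  unfold halfKernel
  by_cases hx : x ∈ Ioi (0 : ℝ)
  · simp only [indicator_of_mem hx]
    have h1 : HasDerivAt (fun z : ℂ => Complex.I * z * x) (Complex.I * x) z := by
      simpa using ((hasDerivAt_id z).const_mul Complex.I).mul_const (x : ℂ)
    exact h1.cexp.congr_deriv (mul_comm _ _)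
  · simp only [indicator_of_notMem hx, mul_zero]
    exact hasDerivAt_const _ _

theorem SuppNonneg.differentiableOn_laplace {f : L2} (hf : SuppNonneg f) :
    DifferentiableOn ℂ (laplace f) Cplus := by
  have heq : laplace f = fun z => ∫ x, f x * halfKernel z x := funext fun z => hf.laplace_eq z
  intro z₀ hz₀
  have hz : 0 < z₀.im := hz₀
  refine DifferentiableAt.differentiableWithinAt ?_
  rw [heq]
  have hd : ∀ z ∈ Metric.ball z₀ (z₀.im / 2), z₀.im / 2 < z.im := by
    intro z hz'
    have h1 : |(z - z₀).im| ≤ ‖z - z₀‖ := Complex.abs_im_le_norm _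
    rw [Metric.mem_ball, dist_eq_norm] at hz'
    rw [Complex.sub_im] at h1
    have := (abs_lt.1 (h1.trans_lt hz')).1
    linarith
  refine (hasDerivAt_integral_of_dominated_loc_of_deriv_le (s := Metric.ball z₀ (z₀.im / 2))
    (F := fun z x => f x * halfKernel z x)
    (F' := fun z x => f x * (Complex.I * x * halfKernel z x))
    (bound := fun x => ‖f x‖ * (4 / z₀.im * ‖(Real.exp (-(z₀.im / 4) * |x|) : ℂ)‖))
    (Metric.ball_mem_nhds z₀ (by positivity)) ?_ ?_ ?_ ?_ ?_ ?_).2.differentiableAt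
  · exact Eventually.of_forall fun z =>
      (Lp.aestronglyMeasurable f).mul (aestronglyMeasurable_halfKernel z)
  · exact (Lp.memLp f).integrable_mul (memLp_halfKernel hz)
  · refine (Lp.aestronglyMeasurable f).mul (AEStronglyMeasurable.mul ?_
      (aestronglyMeasurable_halfKernel z₀))
    exact (by fun_prop : Continuous fun x : ℝ => Complex.I * (x : ℂ)).aestronglyMeasurable
  · refine Eventually.of_forall fun x z hz' => ?_
    rw [norm_mul]
    refine mul_le_mul_of_nonneg_left ?_ (norm_nonneg _)
    have h1 := hd z hz'
    have h2 := norm_halfKernel_le z x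
    simp only [norm_mul, Complex.norm_I, one_mul, Complex.norm_real, Real.norm_eq_abs,
      Real.abs_exp] at h2 ⊢
    -- On the ball the kernel decays at least like e^{-(Im z₀/2)|x|}; half of this rate absorbs the
    -- factor |x| coming from the derivative.
    have h3 : |x| ≤ 4 / z₀.im * Real.exp (z₀.im / 4 * |x|) := by
      have := Real.add_one_le_exp (z₀.im / 4 * |x|)
      calc |x| = 4 / z₀.im * (z₀.im / 4 * |x|) := by field_simp
        _ ≤ _ := by gcongr; linarith
    calc |x| * ‖halfKernel z x‖
        ≤ (4 / z₀.im * Real.exp (z₀.im / 4 * |x|)) * Real.exp (-z.im * |x|) := by gcongr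
      _ ≤ (4 / z₀.im * Real.exp (z₀.im / 4 * |x|)) * Real.exp (-(z₀.im / 2) * |x|) := by
          gcongr
      _ = 4 / z₀.im * Real.exp (-(z₀.im / 4) * |x|) := by
          rw [mul_assoc, ← Real.exp_add]
          congr 2
          ring
  · exact (Lp.memLp f).norm.integrable_mul
      (((memLp_dampFactor (by positivity : 0 < z₀.im / 4)).norm).const_mul (4 / z₀.im))
  · exact Eventually.of_forall fun x z _ => (hasDerivAt_halfKernel z x).const_mul _

/-! ### Hardy spaces -/

theorem lintegral_line (F : ℂ → ℂ) (y : ℝ) :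
    ∫⁻ ξ : ℝ, ‖F (linePt y ξ)‖ₑ ^ 2 = ENNReal.ofReal (2 * Real.pi)⁻¹ *
      ∫⁻ x : ℝ, ‖F ((x : ℂ) + (y : ℂ) * Complex.I)‖ₑ ^ 2 := by
  have ha : -(2 * Real.pi) ≠ 0 := by simp [Real.pi_ne_zero]
  -- The change of variables goes through a measurable embedding, so no measurability of `F` is
  -- needed.
  have h := (Homeomorph.mulLeft₀ _ ha).measurableEmbedding.lintegral_map (μ := volume)
    (fun x : ℝ => ‖F ((x : ℂ) + (y : ℂ) * Complex.I)‖ₑ ^ 2)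
  have h2 : Measure.map (Homeomorph.mulLeft₀ _ ha) (volume : Measure ℝ) =
    ENNReal.ofReal (2 * Real.pi)⁻¹ • volume := by
    have := Real.map_volume_mul_left ha
    rw [inv_neg, abs_neg, abs_of_pos (by positivity)] at this
    exact this
  rw [h2, lintegral_smul_measure] at h
  exact h.symm

theorem integral_line (F : ℂ → ℂ) (y : ℝ) :
    ∫ x : ℝ, F ((x : ℂ) + (y : ℂ) * Complex.I) = 2 * Real.pi * ∫ ξ : ℝ, F (linePt y ξ) := by
  have h := Measure.integral_comp_mul_left
    (fun x : ℝ => F ((x : ℂ) + (y : ℂ) * Complex.I)) (-(2 * Real.pi))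
  rw [inv_neg, abs_neg, abs_of_pos (by positivity)] at h
  have hl : ∀ ξ : ℝ, F (linePt y ξ) =
    F (((-(2 * Real.pi) * ξ : ℝ) : ℂ) + (y : ℂ) * Complex.I) := fun ξ => rfl
  simp only [hl]
  rw [h, Complex.real_smul, ← mul_assoc]
  have hpi : (Real.pi : ℂ) ≠ 0 := by exact_mod_cast Real.pi_ne_zero
  push_cast
  field_simp

/-- Plancherel on each horizontal line, together with the fact that damping does not increase the
norm. -/
theorem SuppNonneg.isHardy_laplace {f : L2} (hf : SuppNonneg f) : IsHardy (laplace f) := by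
  refine ⟨hf.differentiableOn_laplace, 2 * Real.pi * ‖f‖ ^ 2, fun y hy => ?_⟩
  have h1 := lintegral_line (laplace f) y
  rw [lintegral_enorm_sq_congr (fourier_damp_eq_laplace hf hy), Lp.norm_fourier_eq] at h1
  have h2 : ENNReal.ofReal (2 * Real.pi) * ENNReal.ofReal (2 * Real.pi)⁻¹ = 1 := by
    rw [← ENNReal.ofReal_mul (by positivity), mul_inv_cancel₀ (by positivity), ENNReal.ofReal_one]
  calc ∫⁻ x : ℝ, ‖laplace f ((x : ℂ) + (y : ℂ) * Complex.I)‖ₑ ^ 2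
      = ENNReal.ofReal (2 * Real.pi) * ENNReal.ofReal (‖damp y f‖ ^ 2) := by
        rw [h1, ← mul_assoc, h2, one_mul]
    _ = ENNReal.ofReal (2 * Real.pi * ‖damp y f‖ ^ 2) := by
        rw [ENNReal.ofReal_mul (p := 2 * Real.pi) (by positivity)]
    _ ≤ _ := by
        apply ENNReal.ofReal_le_ofReal
        gcongr
        exact norm_damp_le y f

theorem continuous_comp_line {H : ℂ → ℂ} (hH : ContinuousOn H Cplus) {y : ℝ} (hy : 0 < y) :
    Continuous fun ξ => H (linePt y ξ) :=
  hH.comp_continuous (continuous_linePt y) fun ξ => by simpa [Cplus] using hy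

theorem continuous_comp_horizontal {H : ℂ → ℂ} (hH : ContinuousOn H Cplus) {y : ℝ}
    (hy : 0 < y) : Continuous fun x : ℝ => H ((x : ℂ) + (y : ℂ) * Complex.I) :=
  hH.comp_continuous (by fun_prop) fun x => by simpa [Cplus] using hy

theorem IsHardy.memLp_line {H : ℂ → ℂ} (hH : IsHardy H) {y : ℝ} (hy : 0 < y) :
    MemLp (fun ξ => H (linePt y ξ)) 2 volume := by
  obtain ⟨hd, C, hC⟩ := hH
  refine memLp_two_of_lintegral
    (continuous_comp_line hd.continuousOn hy).aestronglyMeasurable ?_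
  rw [lintegral_line]
  exact ENNReal.mul_lt_top ENNReal.ofReal_lt_top ((hC y hy).trans_lt ENNReal.ofReal_lt_top)

theorem IsHardy.exists_line_bound {H : ℂ → ℂ} (hH : IsHardy H) :
    ∃ D : ℝ≥0∞, D < ∞ ∧ ∀ y : ℝ, 0 < y → ∫⁻ ξ : ℝ, ‖H (linePt y ξ)‖ₑ ^ 2 ≤ D := by
  obtain ⟨hd, C, hC⟩ := hH
  refine ⟨ENNReal.ofReal (2 * Real.pi)⁻¹ * ENNReal.ofReal C,
    ENNReal.mul_lt_top ENNReal.ofReal_lt_top ENNReal.ofReal_lt_top, fun y hy => ?_⟩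
  rw [lintegral_line]
  gcongr
  exact hC y hy

/-! ### Shifting the line of integration -/

/-- Cauchy's theorem on the rectangles [-R, R] × [y₁, y₂]. The vertical sides are not estimated
pointwise: by Fubini their integral `V` is an integrable function of R, and V(R) - V(-R) has a
limit, which must then be 0. -/
theorem integral_horizontal_eq_of_le {W : ℂ → ℂ} (hW : DifferentiableOn ℂ W Cplus) {y₁ y₂ : ℝ}
    (h1 : 0 < y₁) (h12 : y₁ ≤ y₂) {C : ℝ≥0∞} (hC : C < ∞)
    (hb : ∀ y ∈ Icc y₁ y₂, ∫⁻ x : ℝ, ‖W ((x : ℂ) + (y : ℂ) * Complex.I)‖ₑ ≤ C) :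
    ∫ x : ℝ, W ((x : ℂ) + (y₁ : ℂ) * Complex.I) = ∫ x : ℝ, W ((x : ℂ) + (y₂ : ℂ) * Complex.I) := by
  have hint : ∀ y ∈ Icc y₁ y₂, Integrable fun x : ℝ => W ((x : ℂ) + (y : ℂ) * Complex.I) :=
    fun y hy => ⟨(continuous_comp_horizontal hW.continuousOn
      (h1.trans_le hy.1)).aestronglyMeasurable, (hb y hy).trans_lt hC⟩
  have hprod : Integrable (fun p : ℝ × ℝ => W ((p.1 : ℂ) + (p.2 : ℂ) * Complex.I))
      (volume.prod (volume.restrict (Ioc y₁ y₂))) := by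
    have hmeas : AEStronglyMeasurable (fun p : ℝ × ℝ => W ((p.1 : ℂ) + (p.2 : ℂ) * Complex.I))
        (volume.prod (volume.restrict (Ioc y₁ y₂))) := by
      have hc : ContinuousOn (fun p : ℝ × ℝ => W ((p.1 : ℂ) + (p.2 : ℂ) * Complex.I))
          (univ ×ˢ Ioc y₁ y₂) := by
        refine hW.continuousOn.comp (by fun_prop) fun p hp => ?_
        simpa [Cplus] using h1.trans hp.2.1
      have := hc.aestronglyMeasurable (μ := volume.prod volume)
        (MeasurableSet.univ.prod measurableSet_Ioc)
      rwa [← Measure.prod_restrict, Measure.restrict_univ] at this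
    refine ⟨hmeas, ?_⟩
    rw [HasFiniteIntegral, lintegral_prod_symm _ hmeas.enorm]
    calc ∫⁻ y in Ioc y₁ y₂, ∫⁻ x : ℝ, ‖W ((x : ℂ) + (y : ℂ) * Complex.I)‖ₑ
        ≤ ∫⁻ _ in Ioc y₁ y₂, C :=
          setLIntegral_mono measurable_const fun y hy => hb y (Ioc_subset_Icc_self hy)
      _ < ∞ := by
          rw [setLIntegral_const]
          exact ENNReal.mul_lt_top hC measure_Ioc_lt_top
  set V : ℝ → ℂ := fun x => ∫ y in y₁..y₂, W ((x : ℂ) + (y : ℂ) * Complex.I) with hV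
  have hVint : Integrable V := by
    have := hprod.integral_prod_left
    refine this.congr (Eventually.of_forall fun x => ?_)
    simp only [hV, intervalIntegral.integral_of_le h12]
  have hrect : ∀ R : ℝ, V R - V (-R) =
      Complex.I * ((∫ x in (-R)..R, W ((x : ℂ) + (y₁ : ℂ) * Complex.I)) -
        ∫ x in (-R)..R, W ((x : ℂ) + (y₂ : ℂ) * Complex.I)) := by
    intro R
    have h := Complex.integral_boundary_rect_eq_zero_of_differentiableOn W
      (⟨-R, y₁⟩ : ℂ) (⟨R, y₂⟩ : ℂ) (hW.mono ?_)
    · simp only [smul_eq_mul] at h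
      simp only [hV]
      linear_combination (-Complex.I) * h + (V R - V (-R)) * Complex.I_sq
    · intro z hz
      have := (Complex.mem_reProdIm.1 hz).2
      rw [uIcc_of_le h12] at this
      exact h1.trans_le this.1
  have hlim : ∀ y ∈ Icc y₁ y₂, Tendsto
      (fun R : ℝ => ∫ x in (-R)..R, W ((x : ℂ) + (y : ℂ) * Complex.I)) atTop
      (𝓝 (∫ x : ℝ, W ((x : ℂ) + (y : ℂ) * Complex.I))) := fun y hy =>
    intervalIntegral_tendsto_integral (hint y hy) tendsto_neg_atTop_atBot tendsto_id
  have h3 := ((hlim y₁ ⟨le_rfl, h12⟩).sub (hlim y₂ ⟨h12, le_rfl⟩)).const_mul Complex.I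
  simp_rw [← hrect] at h3
  have h4 := IntegrableAtFilter.eq_zero_of_tendsto (μ := volume)
    ((hVint.sub hVint.comp_neg).integrableAtFilter atTop) (fun s hs => ?_) h3
  · simpa [sub_eq_zero] using h4
  · obtain ⟨a, ha⟩ := mem_atTop_sets.1 hs
    exact measure_mono_top (fun x hx => ha x hx) Real.volume_Ici

theorem integral_horizontal_eq {W : ℂ → ℂ} (hW : DifferentiableOn ℂ W Cplus)
    (hb : ∀ Y : ℝ, ∃ C : ℝ≥0∞, C < ∞ ∧
      ∀ y ∈ Ioc 0 Y, ∫⁻ x : ℝ, ‖W ((x : ℂ) + (y : ℂ) * Complex.I)‖ₑ ≤ C) {y₁ y₂ : ℝ}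
    (h1 : 0 < y₁) (h2 : 0 < y₂) :
    ∫ x : ℝ, W ((x : ℂ) + (y₁ : ℂ) * Complex.I) = ∫ x : ℝ, W ((x : ℂ) + (y₂ : ℂ) * Complex.I) := by
  wlog h12 : y₁ ≤ y₂ generalizing y₁ y₂
  · exact (this h2 h1 (le_of_not_ge h12)).symm
  obtain ⟨C, hC, hb⟩ := hb y₂
  exact integral_horizontal_eq_of_le hW h1 h12 hC
    fun y hy => hb y ⟨h1.trans_le hy.1, hy.2⟩

/-! ### The Paley–Wiener theorem -/

theorem fourierInv_ae_eq_of_integrable {f : ℝ → ℂ} (h2 : MemLp f 2 volume) (h1 : Integrable f) :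
    (𝓕⁻ (h2.toLp f) : L2) =ᵐ[volume] 𝓕⁻ f := by
  have hL : Continuous fun p : ℝ × ℝ => (-innerₗ ℝ) p.1 p.2 := by
    simp only [LinearMap.neg_apply]
    exact continuous_inner.neg
  have hcont : Continuous (𝓕⁻ f) :=
    VectorFourier.fourierIntegral_continuous Real.continuous_fourierChar hL h1
  refine ae_eq_of_forall_integral_schwartz (locallyIntegrable_L2 _) hcont.locallyIntegrable
    fun g => ?_
  have h := congrArg (fun T => T g) (Lp.fourierInv_toTemperedDistribution_eq (h2.toLp f))
  simp only [TemperedDistribution.fourierInv_apply, Lp.toTemperedDistribution_apply,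
    smul_eq_mul] at h
  have h4 := VectorFourier.integral_fourierIntegral_smul_eq_flip (L := -innerₗ ℝ)
    (f := f) (g := g) (μ := volume) (ν := volume) Real.continuous_fourierChar hL h1 g.integrable
  have hflip : (-innerₗ ℝ).flip = -innerₗ ℝ := by
    ext
    simp
  rw [hflip] at h4
  have h3 : ∫ x, (𝓕⁻ g : 𝓢(ℝ, ℂ)) x * (h2.toLp f) x = ∫ x, f x * (𝓕⁻ g : 𝓢(ℝ, ℂ)) x :=
    integral_congr_ae (by filter_upwards [h2.coeFn_toLp] with x hx; rw [hx, mul_comm])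
  rw [h3, SchwartzMap.fourierInv_coe] at h
  simp only [mul_comm] at h ⊢
  refine h.symm.trans ?_
  simp only [mul_comm _ (𝓕⁻ f _)]
  exact h4.symm

/-- `e^{-itz - εz²}`. -/
def gaussWeight (t ε : ℝ) (z : ℂ) : ℂ := Complex.exp (-(Complex.I * t * z) - ε * z ^ 2)

theorem norm_gaussWeight (t ε x y : ℝ) :
    ‖gaussWeight t ε ((x : ℂ) + (y : ℂ) * Complex.I)‖ =
      Real.exp (t * y + ε * y ^ 2) * Real.exp (-ε * x ^ 2) := by
  rw [gaussWeight, Complex.norm_exp, ← Real.exp_add]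
  congr 1
  simp [pow_two]
  ring

theorem ennreal_mul_le_sq_add_sq (a b : ℝ≥0∞) : a * b ≤ a ^ 2 + b ^ 2 := by
  rcases le_total a b with h | h
  · calc a * b ≤ b * b := by gcongr
      _ = b ^ 2 := (pow_two b).symm
      _ ≤ _ := le_add_self
  · calc a * b ≤ a * a := by gcongr
      _ = a ^ 2 := (pow_two a).symm
      _ ≤ _ := le_self_add

theorem memLp_gaussian {ε : ℝ} (hε : 0 < ε) :
    MemLp (fun x : ℝ => Real.exp (-ε * x ^ 2)) 2 volume := by
  rw [memLp_two_iff_integrable_sq (by fun_prop : Continuous _).aestronglyMeasurable]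
  refine (integrable_exp_neg_mul_sq (b := 2 * ε) (by positivity)).congr
    (Eventually.of_forall fun x => ?_)
  simp only [← Real.exp_nat_mul]
  congr 1
  push_cast
  ring

/-- H is only square integrable on lines. The holomorphic Gaussian factor makes the product
integrable, with a bound uniform for 0 < y ≤ Y, so the contour can be shifted. -/
theorem IsHardy.integral_gaussWeight_eq {H : ℂ → ℂ} (hH : IsHardy H) (t : ℝ) {ε : ℝ}
    (hε : 0 < ε) {y₁ y₂ : ℝ} (h1 : 0 < y₁) (h2 : 0 < y₂) :
    ∫ x : ℝ, H ((x : ℂ) + (y₁ : ℂ) * Complex.I) *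
        gaussWeight t ε ((x : ℂ) + (y₁ : ℂ) * Complex.I) =
      ∫ x : ℝ, H ((x : ℂ) + (y₂ : ℂ) * Complex.I) *
        gaussWeight t ε ((x : ℂ) + (y₂ : ℂ) * Complex.I) := by
  obtain ⟨hd, C, hC⟩ := hH
  refine integral_horizontal_eq (W := fun z => H z * gaussWeight t ε z) (hd.mul ?_) ?_ h1 h2
  · unfold gaussWeight
    fun_prop
  · intro Y
    set M : ℝ := Real.exp (|t| * |Y| + ε * Y ^ 2) with hM
    have hmem := (memLp_gaussian hε).const_mul M
    have hfin := (eLpNorm_lt_top_iff_lintegral_rpow_enorm_lt_top two_ne_zero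
        ENNReal.ofNat_ne_top).1 hmem.2
    refine ⟨ENNReal.ofReal C + ∫⁻ x : ℝ, ‖M * Real.exp (-ε * x ^ 2)‖ₑ ^ 2,
      ENNReal.add_lt_top.2 ⟨ENNReal.ofReal_lt_top, by simpa using hfin⟩, fun y hy => ?_⟩
    calc ∫⁻ x : ℝ, ‖H ((x : ℂ) + (y : ℂ) * Complex.I) *
          gaussWeight t ε ((x : ℂ) + (y : ℂ) * Complex.I)‖ₑ
        ≤ ∫⁻ x : ℝ, (‖H ((x : ℂ) + (y : ℂ) * Complex.I)‖ₑ ^ 2 +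
            ‖M * Real.exp (-ε * x ^ 2)‖ₑ ^ 2) := by
          refine lintegral_mono fun x => ?_
          rw [enorm_mul]
          refine le_trans ?_ (ennreal_mul_le_sq_add_sq _ _)
          gcongr
          rw [enorm_le_iff_norm_le, norm_gaussWeight, norm_mul, Real.norm_eq_abs, hM,
            Real.abs_exp, Real.norm_eq_abs, Real.abs_exp]
          have h3 : t * y ≤ |t| * |Y| :=
            calc t * y ≤ |t| * y := by gcongr; exacts [hy.1.le, le_abs_self t]
              _ ≤ |t| * |Y| := by gcongr; exact hy.2.trans (le_abs_self Y)
          have h4 : y ^ 2 ≤ Y ^ 2 := pow_le_pow_left₀ hy.1.le hy.2 2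
          gcongr
      _ = (∫⁻ x : ℝ, ‖H ((x : ℂ) + (y : ℂ) * Complex.I)‖ₑ ^ 2) +
            ∫⁻ x : ℝ, ‖M * Real.exp (-ε * x ^ 2)‖ₑ ^ 2 := by
          refine lintegral_add_left' ?_ _
          exact (continuous_comp_horizontal hd.continuousOn
            hy.1).aestronglyMeasurable.enorm.pow_const 2
      _ ≤ _ := by
          gcongr
          exact hC y hy.1

/-- The inverse Fourier transform of the restriction of `H` to the line `Im z = y`. -/
def IsHardy.lineInv {H : ℂ → ℂ} (hH : IsHardy H) {y : ℝ} (hy : 0 < y) : L2 :=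
  𝓕⁻ ((hH.memLp_line hy).toLp _)

theorem norm_gaussWeight_zero_line_le {ε : ℝ} (hε : 0 ≤ ε) (y ξ : ℝ) :
    ‖gaussWeight 0 ε (linePt y ξ)‖ ≤ Real.exp (ε * y ^ 2) := by
  rw [linePt, norm_gaussWeight]
  rw [← Real.exp_add, Real.exp_le_exp]
  have := mul_nonneg hε (sq_nonneg (-(2 * Real.pi) * ξ))
  linarith

theorem continuous_gaussWeight (t ε : ℝ) : Continuous (gaussWeight t ε) := by
  unfold gaussWeight; fun_prop

theorem IsHardy.memLp_gauss {H : ℂ → ℂ} (hH : IsHardy H) {y ε : ℝ} (hy : 0 < y) (hε : 0 ≤ ε) :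
    MemLp (fun ξ => H (linePt y ξ) * gaussWeight 0 ε (linePt y ξ)) 2 volume := by
  refine ((hH.memLp_line hy).const_mul (Real.exp (ε * y ^ 2) : ℂ)).of_le
    ((hH.memLp_line hy).1.mul ((continuous_gaussWeight 0 ε).comp
      (continuous_linePt y)).aestronglyMeasurable) (Eventually.of_forall fun ξ => ?_)
  rw [norm_mul, norm_mul, mul_comm, Complex.norm_real, Real.norm_eq_abs, Real.abs_exp]
  gcongr
  exact norm_gaussWeight_zero_line_le hε y ξ

theorem IsHardy.integrable_gauss {H : ℂ → ℂ} (hH : IsHardy H) {y ε : ℝ} (hy : 0 < y)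
    (hε : 0 < ε) : Integrable fun ξ => H (linePt y ξ) * gaussWeight 0 ε (linePt y ξ) := by
  have hg : MemLp (fun ξ => gaussWeight 0 ε (linePt y ξ)) 2 volume := by
    refine ((memLp_gaussian (ε := ε * (2 * Real.pi) ^ 2) (by positivity)).const_mul
      (Real.exp (ε * y ^ 2))).of_le
      ((continuous_gaussWeight 0 ε).comp (continuous_linePt y)).aestronglyMeasurable
      (Eventually.of_forall fun ξ => ?_)
    rw [linePt, norm_gaussWeight, norm_mul, Real.norm_eq_abs, Real.norm_eq_abs, Real.abs_exp,
      Real.abs_exp]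
    refine le_of_eq ?_
    congr 2 <;> ring
  exact (hH.memLp_line hy).integrable_mul hg

/-- Up to the factor 2π each side is the integral of H(z)e^{-isz - εz²} over a horizontal line,
which does not depend on the line. -/
theorem IsHardy.fourierInv_gauss {H : ℂ → ℂ} (hH : IsHardy H) {ε : ℝ} (hε : 0 < ε)
    {y₁ y₂ : ℝ} (h1 : 0 < y₁) (h2 : 0 < y₂) (s : ℝ) :
    (Real.exp (y₁ * s) : ℂ) * 𝓕⁻ (fun ξ => H (linePt y₁ ξ) * gaussWeight 0 ε (linePt y₁ ξ)) s =
      (Real.exp (y₂ * s) : ℂ) *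
        𝓕⁻ (fun ξ => H (linePt y₂ ξ) * gaussWeight 0 ε (linePt y₂ ξ)) s := by
  have key : ∀ y : ℝ, 2 * Real.pi * ((Real.exp (y * s) : ℂ) *
      𝓕⁻ (fun ξ => H (linePt y ξ) * gaussWeight 0 ε (linePt y ξ)) s) =
      ∫ x : ℝ, H ((x : ℂ) + (y : ℂ) * Complex.I) *
        gaussWeight s ε ((x : ℂ) + (y : ℂ) * Complex.I) := by
    intro y
    rw [integral_line (fun z => H z * gaussWeight s ε z), Real.fourierInv_eq',
      ← integral_const_mul]
    congr 1
    refine integral_congr_ae (Eventually.of_forall fun ξ => ?_)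
    simp only [smul_eq_mul]
    have : gaussWeight s ε (linePt y ξ) = (Real.exp (y * s) : ℂ) *
        (Complex.exp (((2 * Real.pi * inner ℝ ξ s : ℝ) : ℂ) * Complex.I) *
          gaussWeight 0 ε (linePt y ξ)) := by
      simp only [gaussWeight, Complex.ofReal_exp, ← Complex.exp_add]
      congr 1
      simp only [linePt, RCLike.inner_apply, conj_trivial]
      push_cast
      linear_combination (-(s : ℂ) * y) * Complex.I_sq
    rw [this]
    ring
  have hpi : (2 * Real.pi : ℂ) ≠ 0 := by simp [Real.pi_ne_zero]
  exact mul_left_cancel₀ hpi ((key y₁).trans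
    ((hH.integral_gaussWeight_eq s hε h1 h2).trans (key y₂).symm))

theorem IsHardy.tendsto_lineInv {H : ℂ → ℂ} (hH : IsHardy H) {y : ℝ} (hy : 0 < y) :
    Tendsto (fun ε : ℝ => (𝓕⁻ ((hH.memLp_gauss hy (abs_nonneg ε)).toLp _) : L2)) (𝓝[>] 0)
      (𝓝 (hH.lineInv hy)) := by
  refine ((FourierTransform.continuous_fourierInv (E := L2)).tendsto _).comp ?_
  have h0 : ∀ᶠ ε : ℝ in 𝓝[>] 0, 0 < ε ∧ ε < 1 := Ioo_mem_nhdsGT one_pos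
  refine tendsto_L2_of_dominated
    (G := fun ε ξ => H (linePt y ξ) * gaussWeight 0 |ε| (linePt y ξ))
    (bound := fun ξ => Real.exp (1 * y ^ 2) * ‖H (linePt y ξ)‖)
    ((hH.memLp_line hy).norm.const_mul _) ?_ ?_ ?_ ?_
  · exact Eventually.of_forall fun ε => MemLp.coeFn_toLp _
  · filter_upwards [h0] with ε hε
    refine Eventually.of_forall fun ξ => ?_
    rw [norm_mul, mul_comm]
    gcongr
    refine (norm_gaussWeight_zero_line_le (abs_nonneg ε) y ξ).trans ?_
    rw [abs_of_pos hε.1]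
    gcongr
    exact hε.2.le
  · filter_upwards [(hH.memLp_line hy).coeFn_toLp] with ξ hξ
    rw [hξ]
    exact le_mul_of_one_le_left (norm_nonneg _) (Real.one_le_exp (by positivity))
  · filter_upwards [(hH.memLp_line hy).coeFn_toLp] with ξ hξ
    rw [hξ]
    have hc : Continuous fun ε : ℝ => H (linePt y ξ) * gaussWeight 0 |ε| (linePt y ξ) := by
      unfold gaussWeight
      fun_prop
    have := hc.tendsto 0
    have e : gaussWeight 0 0 (linePt y ξ) = 1 := by simp [gaussWeight]
    simp only [abs_zero, e, mul_one] at this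
    exact this.mono_left nhdsWithin_le_nhds

/-- The limit ε → 0 of `IsHardy.fourierInv_gauss`, along a sequence on which the regularized inverse
transforms on the line y₁ converge a.e. -/
theorem IsHardy.lineInv_ae {H : ℂ → ℂ} (hH : IsHardy H) {y₁ y₂ : ℝ} (h1 : 0 < y₁)
    (h2 : 0 < y₂) : hH.lineInv h2 =ᵐ[volume]
      fun s => (Real.exp ((y₁ - y₂) * s) : ℂ) * hH.lineInv h1 s := by
  obtain ⟨ns, hns, hae⟩ :=
    (tendstoInMeasure_of_tendsto_Lp (hH.tendsto_lineInv h1)).exists_seq_tendsto_ae'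
  have h0 : ∀ᶠ ε : ℝ in 𝓝[>] 0, 0 < ε := self_mem_nhdsWithin
  refine ae_eq_of_tendsto_L2 ((hH.tendsto_lineInv h2).comp hns) (G := fun n s =>
    (Real.exp ((y₁ - y₂) * s) : ℂ) *
      (𝓕⁻ ((hH.memLp_gauss h1 (abs_nonneg (ns n))).toLp _) : L2) s) ?_ ?_
  · filter_upwards [hns.eventually h0] with n hn
    have hn' : 0 < |ns n| := abs_pos.2 hn.ne'
    filter_upwards [fourierInv_ae_eq_of_integrable (hH.memLp_gauss h1 (abs_nonneg (ns n)))
      (hH.integrable_gauss h1 hn'), fourierInv_ae_eq_of_integrable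
      (hH.memLp_gauss h2 (abs_nonneg (ns n))) (hH.integrable_gauss h2 hn')] with s e1 e2
    simp only [Function.comp_apply]
    rw [e1, e2]
    have h := hH.fourierInv_gauss hn' h1 h2 s
    have hne : (Real.exp (y₂ * s) : ℂ) ≠ 0 := by exact_mod_cast (Real.exp_pos _).ne'
    refine mul_left_cancel₀ hne ?_
    rw [← h, ← mul_assoc, ← Complex.ofReal_mul, ← Real.exp_add]
    ring_nf
  · filter_upwards [hae] with s hs
    exact hs.const_mul _

theorem IsHardy.norm_lineInv_sq_le {H : ℂ → ℂ} (hH : IsHardy H) :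
    ∃ D : ℝ≥0∞, D < ∞ ∧ ∀ (y : ℝ) (hy : 0 < y), ∫⁻ s, ‖hH.lineInv hy s‖ₑ ^ 2 ≤ D := by
  obtain ⟨D, hD, h⟩ := hH.exists_line_bound
  refine ⟨D, hD, fun y hy => ?_⟩
  refine le_trans (le_of_eq ?_) (h y hy)
  rw [lintegral_enorm_sq, lintegral_enorm_sq_congr (hH.memLp_line hy).coeFn_toLp,
    ← Lp.norm_fourier_eq (hH.lineInv hy), IsHardy.lineInv,
    FourierTransform.fourier_fourierInv_eq]

/-- Every function in `H²(ℂ₊)` is the Fourier integral of a function in `L²(0, ∞)`. -/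
theorem IsHardy.exists_laplace_eq {H : ℂ → ℂ} (hH : IsHardy H) :
    ∃ f : L2, SuppNonneg f ∧ ∀ z ∈ Cplus, H z = laplace f z := by
  -- The function e^{ys}·`lineInv` is a.e. independent of y; it is taken at y = 1.
  set h : ℝ → ℂ := fun s => (Real.exp s : ℂ) * hH.lineInv one_pos s with hh
  have hmeas : Measurable h :=
    (by fun_prop : Continuous fun s : ℝ => (Real.exp s : ℂ)).measurable.mul
      (Lp.stronglyMeasurable _).measurable
  have hline : ∀ (y : ℝ) (hy : 0 < y),
      hH.lineInv hy =ᵐ[volume] fun s => (Real.exp (-y * s) : ℂ) * h s := by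
    intro y hy
    filter_upwards [hH.lineInv_ae one_pos hy] with s hs
    rw [hs, hh]
    simp only
    rw [← mul_assoc, ← Complex.ofReal_mul, ← Real.exp_add]
    ring_nf
  obtain ⟨D, hD, hb⟩ := hH.norm_lineInv_sq_le
  have hb' : ∀ y : ℝ, 0 < y → ∫⁻ s, ‖(Real.exp (-y * s) : ℂ) * h s‖ₑ ^ 2 ≤ D := by
    intro y hy
    refine le_trans (le_of_eq (lintegral_congr_ae ?_)) (hb y hy)
    filter_upwards [hline y hy] with s hs
    rw [hs]
  clear_value h
  have hm : ∀ y : ℝ, Measurable (fun s => ‖(Real.exp (-y * s) : ℂ) * h s‖ₑ ^ 2) :=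
    fun y => ((by fun_prop : Continuous fun s : ℝ =>
      (Real.exp (-y * s) : ℂ)).measurable.mul hmeas).enorm.pow_const 2
  -- Fatou's lemma is used twice: heights tending to ∞ force `h` to vanish on s < 0, and heights
  -- tending to 0 give `h` in L².
  have fatou : ∀ y : ℕ → ℝ, (∀ n, 0 < y n) →
      ∫⁻ s, liminf (fun n => ‖(Real.exp (-(y n) * s) : ℂ) * h s‖ₑ ^ 2) atTop ≤ D := by
    intro y hy
    refine (lintegral_liminf_le fun n => hm (y n)).trans ?_
    refine (liminf_le_liminf (Eventually.of_forall fun n => hb' (y n) (hy n))).trans ?_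
    simp
  have hsupp : ∀ᵐ s : ℝ, s < 0 → h s = 0 := by
    have h1 := fatou (fun n => (n : ℝ) + 1) fun n => by positivity
    have h2 := ae_lt_top (Measurable.liminf fun n => hm ((n : ℝ) + 1)) (h1.trans_lt hD).ne
    filter_upwards [h2] with s hs hneg
    by_contra hne
    refine hs.ne (Tendsto.liminf_eq ?_)
    have e1 : Tendsto (fun n : ℕ => Real.exp (-((n : ℝ) + 1) * s)) atTop atTop := by
      refine Real.tendsto_exp_atTop.comp ?_
      have : Tendsto (fun n : ℕ => ((n : ℝ) + 1) * (-s)) atTop atTop :=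
        (tendsto_atTop_add_const_right _ _ tendsto_natCast_atTop_atTop).atTop_mul_const
          (by linarith)
      refine this.congr fun n => by ring
    have e2 : Tendsto (fun n : ℕ => (Real.exp (-((n : ℝ) + 1) * s) * ‖h s‖) ^ 2) atTop atTop :=
      (tendsto_pow_atTop two_ne_zero).comp (e1.atTop_mul_const (norm_pos_iff.2 hne))
    refine (ENNReal.tendsto_ofReal_atTop.comp e2).congr fun n => ?_
    rw [Function.comp_apply, ENNReal.ofReal_pow (by positivity), ← ofReal_norm, norm_mul,
      Complex.norm_real, Real.norm_eq_abs, Real.abs_exp]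
  have hL2 : MemLp h 2 volume := by
    refine memLp_two_of_lintegral hmeas.aestronglyMeasurable (lt_of_le_of_lt ?_ hD)
    refine le_trans (le_of_eq (lintegral_congr fun s => ?_))
      (fatou (fun n => 1 / ((n : ℝ) + 1)) fun n => by positivity)
    refine (Tendsto.liminf_eq ?_).symm
    have e1 : Continuous fun y : ℝ => ‖(Real.exp (-y * s) : ℂ) * h s‖ₑ ^ 2 :=
      (ENNReal.continuous_pow 2).comp (by fun_prop)
    have := (e1.tendsto 0).comp tendsto_one_div_add_atTop_nhds_zero_nat
    simpa [Function.comp_def] using this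
  refine ⟨hL2.toLp h, ?_, ?_⟩
  · filter_upwards [hsupp, hL2.coeFn_toLp] with s h1 h2 h3
    rw [h2, h1 h3]
  · have hs : SuppNonneg (hL2.toLp h) := by
      filter_upwards [hsupp, hL2.coeFn_toLp] with s h1 h2 h3
      rw [h2, h1 h3]
    intro z hz
    have hy : 0 < z.im := hz
    have hdamp : damp z.im (hL2.toLp h) = hH.lineInv hy := by
      refine Lp.ext ?_
      filter_upwards [damp_ae hy.le (hL2.toLp h), hL2.coeFn_toLp, hline _ hy, hsupp]
        with s h1 h2 h3 h4
      rw [h1, h2, h3]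
      rcases lt_or_ge s 0 with h5 | h5
      · simp [h4 h5]
      · rw [abs_of_nonneg h5]
    have hF := fourier_damp_eq_laplace hs hy
    rw [hdamp, IsHardy.lineInv, FourierTransform.fourier_fourierInv_eq] at hF
    -- Both sides are continuous on the line, so a.e. equality holds at every point, in particular
    -- at z.
    have heq := (Continuous.ae_eq_iff_eq volume
      (continuous_comp_line hH.1.continuousOn hy)
      (continuous_comp_line hs.differentiableOn_laplace.continuousOn hy)).1
      ((hH.memLp_line hy).coeFn_toLp.symm.trans hF)
    have hz' : linePt z.im (-(2 * Real.pi)⁻¹ * z.re) = z := by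
      have : -(2 * Real.pi) * (-(2 * Real.pi)⁻¹ * z.re) = z.re := by
        field_simp
      rw [linePt, this, Complex.re_add_im]
    have := congrFun heq (-(2 * Real.pi)⁻¹ * z.re)
    rwa [hz'] at this

/-! ### Multiplication by bounded holomorphic functions -/

theorem linePt_mem {y : ℝ} (hy : 0 < y) (ξ : ℝ) : linePt y ξ ∈ Cplus := by
  simpa [Cplus] using hy

theorem IsInner.isHardy_mul {θ F : ℂ → ℂ} (hθ : IsInner θ) (hF : IsHardy F) :
    IsHardy fun z => θ z * F z := by
  obtain ⟨C, hC⟩ := hθ.bounded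
  obtain ⟨hd, B, hB⟩ := hF
  refine ⟨hθ.differentiableOn.mul hd, C ^ 2 * B, fun y hy => ?_⟩
  have hmem : ∀ x : ℝ, (x : ℂ) + (y : ℂ) * Complex.I ∈ Cplus := fun x => by
    simpa [Cplus] using hy
  calc ∫⁻ x : ℝ, ‖θ ((x : ℂ) + (y : ℂ) * Complex.I) * F ((x : ℂ) + (y : ℂ) * Complex.I)‖ₑ ^ 2
      ≤ ∫⁻ x : ℝ, ENNReal.ofReal (C ^ 2) * ‖F ((x : ℂ) + (y : ℂ) * Complex.I)‖ₑ ^ 2 := by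
        refine lintegral_mono fun x => ?_
        have hCx := hC _ (hmem x)
        rw [enorm_mul, mul_pow, ENNReal.ofReal_pow ((norm_nonneg _).trans hCx)]
        gcongr
        rw [← ofReal_norm]
        exact ENNReal.ofReal_le_ofReal hCx
    _ = ENNReal.ofReal (C ^ 2) * ∫⁻ x : ℝ, ‖F ((x : ℂ) + (y : ℂ) * Complex.I)‖ₑ ^ 2 := by
        refine lintegral_const_mul' _ _ ENNReal.ofReal_ne_top
    _ ≤ ENNReal.ofReal (C ^ 2) * ENNReal.ofReal B := by
        gcongr
        exact hB y hy
    _ = _ := (ENNReal.ofReal_mul (sq_nonneg C)).symm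

theorem IsBoundaryValue.tendsto_line {u : ℝ → ℂ} {θ : ℂ → ℂ} (huθ : IsBoundaryValue u θ) :
    ∀ᵐ ξ : ℝ, Tendsto (fun y => θ (linePt y ξ)) (𝓝[>] 0) (𝓝 (u (-(2 * Real.pi) * ξ))) := by
  have hq := quasiMeasurePreserving_mul (c := -(2 * Real.pi)) (by simp [Real.pi_ne_zero])
  filter_upwards [hq.ae huθ] with ξ hξ
  -- The vertical approach stays in every cone; aperture 1 is an arbitrary choice.
  refine (hξ 1 one_pos).comp ?_
  refine tendsto_nhdsWithin_iff.2 ⟨?_, ?_⟩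
  · have hc : Continuous fun y : ℝ => linePt y ξ := by unfold linePt; fun_prop
    have := hc.tendsto 0
    simp only [linePt, Complex.ofReal_zero, zero_mul, add_zero] at this
    exact this.mono_left nhdsWithin_le_nhds
  · filter_upwards [self_mem_nhdsWithin] with y hy
    have hy' : 0 < y := hy
    have hre : (linePt y ξ).re = -(2 * Real.pi) * ξ := by simp [linePt]
    simp [hre, hy', hy'.le]

theorem tendsto_fourier_damp (f : L2) :
    Tendsto (fun y => (𝓕 (damp y f) : L2)) (𝓝[>] 0) (𝓝 (𝓕 f)) :=
  ((FourierTransform.continuous_fourier (E := L2)).tendsto f).comp (tendsto_damp f)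

/-- Multiplication by `θ` on `H²(ℂ₊)`, in terms of the `L²(0, ∞)` functions. -/
theorem SuppNonneg.exists_mul {u : ℝ → ℂ} {θ : ℂ → ℂ} (hθ : IsInner θ)
    (huθ : IsBoundaryValue u θ) {f : L2} (hf : SuppNonneg f) :
    ∃ k : L2, SuppNonneg k ∧ (∀ z ∈ Cplus, laplace k z = θ z * laplace f z) ∧
      (𝓕 k : L2) =ᵐ[volume] fun ξ => u (-(2 * Real.pi) * ξ) * (𝓕 f : L2) ξ := by
  obtain ⟨k, hk, hkθ⟩ := (hθ.isHardy_mul hf.isHardy_laplace).exists_laplace_eq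
  refine ⟨k, hk, fun z hz => (hkθ z hz).symm, ?_⟩
  -- On each line Im z = y the transforms of `k` and `f` differ by the factor θ; the boundary
  -- relation is the limit y → 0 along a subsequence.
  obtain ⟨ns, hns, hae⟩ :=
    (tendstoInMeasure_of_tendsto_Lp (tendsto_fourier_damp f)).exists_seq_tendsto_ae'
  refine ae_eq_of_tendsto_L2 ((tendsto_fourier_damp k).comp hns) (G := fun n ξ =>
    θ (linePt (ns n) ξ) * (𝓕 (damp (ns n) f) : L2) ξ) ?_ ?_
  · have h0 : ∀ᶠ y : ℝ in 𝓝[>] 0, 0 < y := self_mem_nhdsWithin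
    filter_upwards [hns.eventually h0] with n hn
    filter_upwards [fourier_damp_eq_laplace hk hn, fourier_damp_eq_laplace hf hn] with ξ h1 h2
    rw [Function.comp_apply, h1, h2, ← hkθ _ (linePt_mem hn ξ)]
  · filter_upwards [hae, huθ.tendsto_line] with ξ h1 h2
    exact (h2.comp hns).mul h1

/-! ### The operator `K` -/

theorem fourier_K_ae {u : ℝ → ℂ} (hu : IsUnimodular u) (f : L2) :
    (𝓕 (K hu f) : L2) =ᵐ[volume] fun ξ => u (-(2 * Real.pi) * ξ) * conj ((𝓕 f : L2) ξ) := by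
  rw [K, FourierTransform.fourier_fourierInv_eq]
  exact MemLp.coeFn_toLp _

theorem eq_of_fourier_ae_eq {f g : L2} (h : (𝓕 f : L2) =ᵐ[volume] (𝓕 g : L2)) : f = g := by
  have := congrArg (fun F : L2 => (𝓕⁻ F : L2)) (Lp.ext h)
  simpa [FourierTransform.fourierInv_fourier_eq] using this

theorem K_zero {u : ℝ → ℂ} (hu : IsUnimodular u) : K hu 0 = 0 := by
  refine eq_of_fourier_ae_eq ?_
  have h0 : (𝓕 (0 : L2) : L2) = 0 := (Lp.fourierTransformₗᵢ ℝ ℂ).map_zero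
  filter_upwards [fourier_K_ae hu 0, Lp.coeFn_zero ℂ 2 (volume : Measure ℝ)] with ξ h1 h2
  rw [h1, h0, h2]
  simp

/-- The conjugate of the transform of `f` is the transform of `conjRefl f`, so K acts as
multiplication by θ on H²(ℂ₊), which preserves H². -/
theorem K_of_suppNonneg_conjRefl {u : ℝ → ℂ} {θ : ℂ → ℂ} (hu : IsUnimodular u)
    (hθ : IsInner θ) (huθ : IsBoundaryValue u θ) {f : L2} (hf : SuppNonneg (conjRefl f)) :
    SuppNonneg (K hu f) ∧ ∀ z ∈ Cplus, laplace (K hu f) z = θ z * laplace (conjRefl f) z := by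
  obtain ⟨k, hk, hkθ, hku⟩ := hf.exists_mul hθ huθ
  have : K hu f = k := by
    refine eq_of_fourier_ae_eq ?_
    filter_upwards [fourier_K_ae hu f, hku, fourier_conjRefl f] with ξ h1 h2 h3
    rw [h1, h2, h3]
  rw [this]
  exact ⟨hk, hkθ⟩

theorem P_ae (t : ℝ) (f : L2) : P t f =ᵐ[volume] (Iio t).indicator f :=
  MemLp.coeFn_toLp _

theorem suppNonneg_conjRefl_iff (f : L2) :
    SuppNonneg (conjRefl f) ↔ ∀ᵐ x : ℝ, 0 < x → f x = 0 := by
  have hq := (Measure.measurePreserving_neg (volume : Measure ℝ)).quasiMeasurePreserving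
  constructor
  · intro h
    filter_upwards [hq.ae h, hq.ae (conjRefl_ae f)] with x h1 h2 hx
    have := h1 (by linarith)
    rw [h2] at this
    simpa using this
  · intro h
    filter_upwards [hq.ae h, conjRefl_ae f] with x h1 h2 hx
    rw [h2, h1 (by linarith), map_zero]

theorem suppNonneg_conjRefl_P (f : L2) : SuppNonneg (conjRefl (P 0 f)) := by
  rw [suppNonneg_conjRefl_iff]
  filter_upwards [P_ae 0 f] with x hx h0
  rw [hx, indicator_of_notMem (by simpa using h0.le)]

theorem P_zero_eq_zero_iff (f : L2) : P 0 f = 0 ↔ SuppNonneg f := by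
  rw [Lp.eq_zero_iff_ae_eq_zero]
  constructor <;> intro h
  · filter_upwards [h, P_ae 0 f] with x h1 h2 hx
    rw [h2, indicator_of_mem (by simpa using hx)] at h1
    simpa using h1
  · filter_upwards [h, P_ae 0 f] with x h1 h2
    rw [h2]
    by_cases hx : x < 0
    · simp [hx, h1 hx]
    · simp [hx]

/-- K maps L²(-∞, 0) into L²(0, ∞), so the compression is zero. -/
theorem normCompressionLtOne_zero {u : ℝ → ℂ} {θ : ℂ → ℂ} (hu : IsUnimodular u)
    (hθ : IsInner θ) (huθ : IsBoundaryValue u θ) : NormCompressionLtOne hu 0 := by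
  refine ⟨0, one_pos, fun f => ?_⟩
  rw [(P_zero_eq_zero_iff _).2 (K_of_suppNonneg_conjRefl hu hθ huθ (suppNonneg_conjRefl_P f)).1]
  simp

/-! ### The model space -/

/-- By Plancherel the integral at height y is 2π times the inner product of the damped functions. -/
theorem tendsto_integral_laplace_mul_conj {f k : L2} (hf : SuppNonneg f) (hk : SuppNonneg k) :
    Tendsto (fun y : ℝ => ∫ x : ℝ, laplace f ((x : ℂ) + (y : ℂ) * Complex.I) *
      conj (laplace k ((x : ℂ) + (y : ℂ) * Complex.I))) (𝓝[>] 0)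
      (𝓝 (2 * Real.pi * inner ℂ k f)) := by
  have h1 : Tendsto (fun y => 2 * Real.pi * inner ℂ (damp y k) (damp y f)) (𝓝[>] 0)
      (𝓝 (2 * Real.pi * inner ℂ k f)) :=
    ((tendsto_damp k).inner (tendsto_damp f)).const_mul _
  refine h1.congr' ?_
  filter_upwards [self_mem_nhdsWithin] with y hy
  have hy' : 0 < y := hy
  rw [integral_line (fun z => laplace f z * conj (laplace k z)), ← Lp.inner_fourier_eq,
    L2.inner_def]
  congr 1
  refine integral_congr_ae ?_
  filter_upwards [fourier_damp_eq_laplace hf hy', fourier_damp_eq_laplace hk hy'] with ξ e1 e2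
  rw [e1, e2]
  simp

/-- After Plancherel both integrands are the product of conj u, the transform of f and the conjugate
transform of g. This turns orthogonality to θH² into a support condition on K f. -/
theorem inner_eq_inner_K {u : ℝ → ℂ} (hu : IsUnimodular u) {f g k : L2}
    (hk : (𝓕 k : L2) =ᵐ[volume] fun ξ => u (-(2 * Real.pi) * ξ) * (𝓕 g : L2) ξ) :
    inner ℂ k f = inner ℂ (K hu f) (conjRefl g) := by
  rw [← Lp.inner_fourier_eq k, ← Lp.inner_fourier_eq (K hu f), L2.inner_def, L2.inner_def]
  refine integral_congr_ae ?_
  filter_upwards [hk, fourier_K_ae hu f, fourier_conjRefl g] with ξ h1 h2 h3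
  rw [h1, h2, h3]
  simp only [RCLike.inner_apply, map_mul, Complex.conj_conj]
  ring

theorem inner_P_eq (f : L2) : inner ℂ f (P 0 f) = ((‖P 0 f‖ ^ 2 : ℝ) : ℂ) := by
  have h : inner ℂ f (P 0 f) = inner ℂ (P 0 f) (P 0 f) := by
    rw [L2.inner_def, L2.inner_def]
    refine integral_congr_ae ?_
    filter_upwards [P_ae 0 f] with x hx
    rw [hx]
    by_cases h0 : x < 0 <;> simp [h0]
  rw [h, inner_self_eq_norm_sq_to_K]
  simp

theorem hardyOrthogonal_congr {F F' G G' : ℂ → ℂ} (hF : ∀ z ∈ Cplus, F z = F' z)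
    (hG : ∀ z ∈ Cplus, G z = G' z) (h : HardyOrthogonal F G) : HardyOrthogonal F' G' := by
  refine Tendsto.congr' ?_ h
  filter_upwards [self_mem_nhdsWithin] with y hy
  have hmem : ∀ x : ℝ, (x : ℂ) + (y : ℂ) * Complex.I ∈ Cplus := fun x => by
    simpa [Cplus] using hy
  simp only [hF _ (hmem _), hG _ (hmem _)]

theorem hardyOrthogonal_laplace_iff {f k : L2} (hf : SuppNonneg f) (hk : SuppNonneg k) :
    HardyOrthogonal (laplace f) (laplace k) ↔ inner ℂ k f = (0 : ℂ) := by
  have h := tendsto_integral_laplace_mul_conj hf hk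
  constructor
  · intro h0
    have := tendsto_nhds_unique h h0
    simpa [Real.pi_ne_zero] using this
  · intro h0
    rw [h0, mul_zero] at h
    exact h

theorem fourierV_eq_modelSpace {u : ℝ → ℂ} {θ : ℂ → ℂ} (hu : IsUnimodular u)
    (hθ : IsInner θ) (huθ : IsBoundaryValue u θ) : fourierV hu 0 = modelSpace θ := by
  ext F
  constructor
  · rintro ⟨f, ⟨hf, hKf⟩, hF⟩
    have hf' : SuppNonneg f := hf
    refine ⟨laplace f, hf'.isHardy_laplace, fun G hG => ?_, hF⟩
    obtain ⟨g, hg, hGg⟩ := hG.exists_laplace_eq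
    obtain ⟨k, hk, hkθ, hku⟩ := hg.exists_mul hθ huθ
    refine hardyOrthogonal_congr (fun z _ => rfl) (fun z hz => ?_)
      ((hardyOrthogonal_laplace_iff hf' hk).2 ?_)
    · rw [hkθ z hz, hGg z hz]
    · rw [inner_eq_inner_K hu hku, L2.inner_def]
      refine integral_eq_zero_of_ae ?_
      -- `conjRefl g` lives on (-∞, 0] and K f on [0, ∞), so the integrand vanishes a.e.
      have hq := (suppNonneg_conjRefl_iff (conjRefl g)).1 (by rwa [conjRefl_conjRefl])
      filter_upwards [hKf, hq, (volume : Measure ℝ).ae_ne 0] with x h1 h2 h0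
      rcases lt_or_gt_of_ne h0 with h | h
      · simp [h1 h]
      · simp [h2 h]
  · rintro ⟨H, hH, horth, hF⟩
    obtain ⟨f, hf, hHf⟩ := hH.exists_laplace_eq
    refine ⟨f, ⟨hf, ?_⟩, fun z => by rw [hF z, hHf z z.2]; rfl⟩
    -- Testing orthogonality with g = `conjRefl (P 0 (K hu f))` makes the inner product equal to ‖P₀
    -- K f‖².
    have hg := suppNonneg_conjRefl_P (K hu f)
    obtain ⟨k, hk, hkθ, hku⟩ := hg.exists_mul hθ huθ
    have h1 := hardyOrthogonal_congr hHf (fun z hz => (hkθ z hz).symm)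
      (horth _ hg.isHardy_laplace)
    rw [hardyOrthogonal_laplace_iff hf hk, inner_eq_inner_K hu hku, conjRefl_conjRefl,
      inner_P_eq] at h1
    have h2 : P 0 (K hu f) = 0 := by simpa using h1
    exact (P_zero_eq_zero_iff _).1 h2

/-! ### Exponentials on the half-line -/

theorem integrable_halfKernel {z : ℂ} (hz : 0 < z.im) : Integrable (halfKernel z) :=
  (integrable_indicator_iff measurableSet_Ioi).2
    (integrableOn_exp_mul_complex_Ioi (a := Complex.I * z) (by simpa using hz) 0)

theorem integral_halfKernel {z : ℂ} (hz : 0 < z.im) : ∫ x, halfKernel z x = Complex.I / z := by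
  have hz0 : z ≠ 0 := by
    rintro rfl
    simp at hz
  unfold halfKernel
  rw [integral_indicator measurableSet_Ioi,
    integral_exp_mul_complex_Ioi (a := Complex.I * z) (by simpa using hz)]
  simp only [Complex.ofReal_zero, mul_zero, Complex.exp_zero]
  rw [div_eq_div_iff (mul_ne_zero Complex.I_ne_zero hz0) hz0]
  linear_combination (-z) * Complex.I_sq

theorem halfKernel_mul (z w : ℂ) (x : ℝ) :
    halfKernel z x * halfKernel w x = halfKernel (w + z) x := by
  unfold halfKernel
  by_cases hx : x ∈ Ioi (0 : ℝ)
  · simp only [indicator_of_mem hx, ← Complex.exp_add]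
    ring_nf
  · simp only [indicator_of_notMem hx, mul_zero]

theorem norm_halfKernel_le_one {z : ℂ} (hz : 0 ≤ z.im) (x : ℝ) : ‖halfKernel z x‖ ≤ 1 :=
  (norm_halfKernel_le z x).trans (norm_dampFactor_le hz x)

/-- The function `e^{-εx} 1_{x > 0}`, and `0` if `ε ≤ 0`. -/
def halfExp (ε : ℝ) : L2 :=
  if h : 0 < ε then (memLp_halfKernel (z := ε * Complex.I) (by simpa using h)).toLp _ else 0

theorem halfExp_ae {ε : ℝ} (hε : 0 < ε) :
    halfExp ε =ᵐ[volume] halfKernel (ε * Complex.I) := by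
  rw [halfExp, dif_pos hε]
  exact MemLp.coeFn_toLp _

theorem suppNonneg_halfExp {ε : ℝ} (hε : 0 < ε) : SuppNonneg (halfExp ε) := by
  filter_upwards [halfExp_ae hε] with x hx h0
  rw [hx, halfKernel, indicator_of_notMem (by simpa using h0.le)]

theorem laplace_halfExp {ε : ℝ} (hε : 0 < ε) {z : ℂ} (hz : 0 < z.im) :
    laplace (halfExp ε) z = Complex.I / (z + ε * Complex.I) := by
  rw [(suppNonneg_halfExp hε).laplace_eq, ← integral_halfKernel (by simpa using by positivity)]
  refine integral_congr_ae ?_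
  filter_upwards [halfExp_ae hε] with x hx
  rw [hx, halfKernel_mul]

theorem fourier_halfExp {ε : ℝ} (hε : 0 < ε) :
    (𝓕 (halfExp ε) : L2) =ᵐ[volume] fun ξ => Complex.I / linePt ε ξ := by
  have him : 0 < ((ε : ℂ) * Complex.I).im := by simpa using hε
  rw [halfExp, dif_pos hε]
  filter_upwards [fourier_ae_eq_of_integrable (memLp_halfKernel him) (integrable_halfKernel him)]
    with ξ hξ
  rw [hξ, fourier_eq_integral_exp, ← integral_halfKernel (by simpa using hε)]
  refine integral_congr_ae (Eventually.of_forall fun x => ?_)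
  simp only [linePt, halfKernel]
  by_cases hx : x ∈ Ioi (0 : ℝ)
  · simp only [indicator_of_mem hx, ← Complex.exp_add]
    ring_nf
  · simp only [indicator_of_notMem hx, zero_mul]

/-! ### Linearity -/

theorem SuppNonneg.sub_smul {f g : L2} (hf : SuppNonneg f) (hg : SuppNonneg g) (c : ℂ) :
    SuppNonneg (f - c • g) := by
  filter_upwards [hf, hg, Lp.coeFn_sub f (c • g), Lp.coeFn_smul c g] with x h1 h2 h3 h4 hx
  rw [h3, Pi.sub_apply, h4, Pi.smul_apply, h1 hx, h2 hx]
  simp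

theorem SuppNonneg.laplace_sub_smul {f g : L2} (hf : SuppNonneg f) (hg : SuppNonneg g) (c : ℂ)
    {z : ℂ} (hz : 0 < z.im) : laplace (f - c • g : L2) z = laplace f z - c * laplace g z := by
  unfold laplace
  rw [← integral_const_mul, ← integral_sub (hf.integrable_mul_exp hz)
    ((hg.integrable_mul_exp hz).const_mul c)]
  refine integral_congr_ae ?_
  filter_upwards [Lp.coeFn_sub f (c • g), Lp.coeFn_smul c g] with x h3 h4
  rw [h3, Pi.sub_apply, h4, Pi.smul_apply, smul_eq_mul]
  ring

theorem fourier_sub_smul_ae (f g : L2) (c : ℂ) :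
    (𝓕 (f - c • g) : L2) =ᵐ[volume] fun ξ => (𝓕 f : L2) ξ - c * (𝓕 g : L2) ξ := by
  have h : (𝓕 (f - c • g) : L2) = 𝓕 f - c • (𝓕 g : L2) := by
    change Lp.fourierTransformₗᵢ ℝ ℂ (f - c • g) = _
    rw [map_sub, map_smul]
    rfl
  rw [h]
  filter_upwards [Lp.coeFn_sub (𝓕 f : L2) (c • (𝓕 g : L2)), Lp.coeFn_smul c (𝓕 g : L2)]
    with ξ h1 h2
  rw [h1, Pi.sub_apply, h2, Pi.smul_apply, smul_eq_mul]

/-! ### Hölder continuity at the origin -/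

theorem integrable_of_even {f : ℝ → ℝ} (hf : ∀ x, f (-x) = f x) (h : IntegrableOn f (Ioi 0)) :
    Integrable f := by
  have h1 : IntegrableOn f (Iio 0) := by
    have := h.comp_neg
    simpa [hf] using this
  have h2 := ((integrableOn_Iic_iff_integrableOn_Iio (by finiteness)).2 h1).union h
  rwa [Iic_union_Ioi, integrableOn_univ] at h2

/-- The square near 0 is |ξ|^{2(α-1)}, integrable precisely because α > 1/2; at infinity it is
|ξ|⁻². -/
theorem memLp_holder_bound {α d A B : ℝ} (hα : 1 / 2 < α) (hd : 0 < d) :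
    MemLp (fun ξ : ℝ => if |ξ| < d then A * |ξ| ^ (α - 1) else B * |ξ|⁻¹) 2 volume := by
  have hmeas : Measurable fun ξ : ℝ => if |ξ| < d then A * |ξ| ^ (α - 1) else B * |ξ|⁻¹ :=
    Measurable.ite (measurableSet_lt (by fun_prop) measurable_const) (by fun_prop) (by fun_prop)
  rw [memLp_two_iff_integrable_sq hmeas.aestronglyMeasurable]
  refine integrable_of_even (fun x => by simp only [abs_neg]) ?_
  have h1 : IntegrableOn (fun x : ℝ => A ^ 2 * x ^ (2 * (α - 1))) (Ioc 0 d) :=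
    ((intervalIntegral.intervalIntegrable_rpow' (a := 0) (b := d)
      (by linarith : -1 < 2 * (α - 1))).1).const_mul _
  have h2 : IntegrableOn (fun x : ℝ => B ^ 2 * x ^ (-2 : ℝ)) (Ici d) :=
    ((integrableOn_Ici_iff_integrableOn_Ioi (by finiteness)).2
      (integrableOn_Ioi_rpow_of_lt (by norm_num) hd)).const_mul _
  have h3 : IntegrableOn (fun ξ : ℝ => (if |ξ| < d then A * |ξ| ^ (α - 1) else B * |ξ|⁻¹) ^ 2)
      (Ioo 0 d) := by
    refine (h1.mono_set Ioo_subset_Ioc_self).congr_fun (fun x hx => ?_) measurableSet_Ioo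
    simp only [abs_of_pos hx.1, if_pos hx.2]
    rw [mul_pow, ← Real.rpow_natCast (x ^ (α - 1)), ← Real.rpow_mul hx.1.le]
    push_cast
    ring_nf
  have h4 : IntegrableOn (fun ξ : ℝ => (if |ξ| < d then A * |ξ| ^ (α - 1) else B * |ξ|⁻¹) ^ 2)
      (Ici d) := by
    refine h2.congr_fun (fun x hx => ?_) measurableSet_Ici
    have hx0 : 0 < x := hd.trans_le hx
    simp only [abs_of_pos hx0, if_neg (not_lt.2 (mem_Ici.1 hx))]
    rw [mul_pow, Real.rpow_neg hx0.le, Real.rpow_two, inv_pow]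
  have := h3.union h4
  rwa [Ioo_union_Ici_eq_Ioi hd] at this

/-- The real part of `linePt ε ξ` does not involve ε, so the bound is uniform in ε. -/
theorem norm_I_div_linePt_le (ε : ℝ) {ξ : ℝ} (hξ : ξ ≠ 0) :
    ‖Complex.I / linePt ε ξ‖ ≤ (2 * Real.pi)⁻¹ * |ξ|⁻¹ := by
  have h : 2 * Real.pi * |ξ| ≤ ‖linePt ε ξ‖ := by
    have := Complex.abs_re_le_norm (linePt ε ξ)
    have hre : (linePt ε ξ).re = -(2 * Real.pi) * ξ := by simp [linePt]
    rwa [hre, abs_mul, abs_neg, abs_of_pos (by positivity)] at this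
  rw [norm_div, Complex.norm_I, one_div, ← mul_inv]
  gcongr

/-- Supplies one L² majorant valid for all ε, as dominated convergence for ε → 0 requires. -/
theorem exists_holder_bound {u : ℝ → ℂ} (hu : IsUnimodular u) {u₀ : ℂ} {α C δ : ℝ}
    (hα : 1 / 2 < α) (hδ : 0 < δ) (hC : ∀ᵐ x : ℝ, |x| < δ → ‖u x - u₀‖ ≤ C * |x| ^ α) :
    ∃ b : ℝ → ℝ, MemLp b 2 volume ∧
      ∀ᵐ ξ : ℝ, ∀ ε : ℝ, ‖(u (-(2 * Real.pi) * ξ) - u₀) * (Complex.I / linePt ε ξ)‖ ≤ b ξ := by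
  have hpi : 0 < 2 * Real.pi := by positivity
  have hq := quasiMeasurePreserving_mul (c := -(2 * Real.pi)) (by simp [Real.pi_ne_zero])
  -- The Hölder condition is in x = -2πξ, hence the rescaled radius and constant; away from 0 the
  -- bound is |u - u₀| ≤ 1 + |u₀|.
  refine ⟨_, memLp_holder_bound (d := δ / (2 * Real.pi))
    (A := C * (2 * Real.pi) ^ α * (2 * Real.pi)⁻¹)
    (B := (1 + ‖u₀‖) * (2 * Real.pi)⁻¹) hα (by positivity), ?_⟩
  filter_upwards [hq.ae hC, hq.ae hu.norm_eq_one, (volume : Measure ℝ).ae_ne 0]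
    with ξ h1 h2 h0 ε
  have habs : |-(2 * Real.pi) * ξ| = 2 * Real.pi * |ξ| := by
    rw [abs_mul, abs_neg, abs_of_pos hpi]
  have hξ : 0 < |ξ| := abs_pos.2 h0
  rw [norm_mul]
  refine (mul_le_mul_of_nonneg_left (norm_I_div_linePt_le ε h0) (norm_nonneg _)).trans ?_
  split_ifs with hd
  · rw [habs] at h1
    have h3 := h1 (by rwa [lt_div_iff₀' hpi] at hd)
    rw [Real.mul_rpow hpi.le hξ.le] at h3
    calc ‖u (-(2 * Real.pi) * ξ) - u₀‖ * ((2 * Real.pi)⁻¹ * |ξ|⁻¹)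
        ≤ (C * ((2 * Real.pi) ^ α * |ξ| ^ α)) * ((2 * Real.pi)⁻¹ * |ξ|⁻¹) := by gcongr
      _ = C * (2 * Real.pi) ^ α * (2 * Real.pi)⁻¹ * |ξ| ^ (α - 1) := by
          rw [Real.rpow_sub_one hξ.ne']
          ring
  · calc ‖u (-(2 * Real.pi) * ξ) - u₀‖ * ((2 * Real.pi)⁻¹ * |ξ|⁻¹)
        ≤ (1 + ‖u₀‖) * ((2 * Real.pi)⁻¹ * |ξ|⁻¹) := by
          gcongr
          exact (norm_sub_le _ _).trans (by rw [h2])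
      _ = _ := by ring

/-! ### The function `K (P_0 1)` -/

theorem conjRefl_halfExp_ae {ε : ℝ} (hε : 0 < ε) :
    conjRefl (halfExp ε) =ᵐ[volume] fun x => (Real.exp (-ε * |x|) : ℂ) * Pone 0 x := by
  have hq := (Measure.measurePreserving_neg (volume : Measure ℝ)).quasiMeasurePreserving
  filter_upwards [conjRefl_ae (halfExp ε), hq.ae (halfExp_ae hε)] with x h1 h2
  rw [h1, h2, halfKernel, Pone]
  by_cases hx : x < 0
  · rw [indicator_of_mem (by simpa using hx), indicator_of_mem (by simpa using hx),
      ← Complex.exp_conj, abs_of_neg hx, Complex.ofReal_exp, Pi.one_apply, mul_one]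
    congr 1
    simp only [map_mul, Complex.conj_I, Complex.conj_ofReal]
    push_cast
    linear_combination (-(ε : ℂ) * x) * Complex.I_sq
  · rw [indicator_of_notMem (by simpa using hx), indicator_of_notMem (by simpa using hx)]
    simp

theorem integrable_halfKernel_zero_mul (g : 𝓢(ℝ, ℂ)) :
    Integrable fun x => halfKernel 0 x * g x := by
  refine g.integrable.mono ((aestronglyMeasurable_halfKernel 0).mul
    g.continuous.aestronglyMeasurable) (Eventually.of_forall fun x => ?_)
  rw [norm_mul]
  exact mul_le_of_le_one_left (norm_nonneg _) (norm_halfKernel_le_one (by simp) x)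

/-- This part of the limit exists only in the sense of distributions, since 1_{x>0} is not in L². -/
theorem tendsto_integral_halfExp_mul (g : 𝓢(ℝ, ℂ)) :
    Tendsto (fun ε => ∫ x, halfExp ε x * g x) (𝓝[>] 0) (𝓝 (∫ x, halfKernel 0 x * g x)) := by
  have h0 : ∀ᶠ ε : ℝ in 𝓝[>] 0, 0 < ε := self_mem_nhdsWithin
  have h1 : Tendsto (fun ε : ℝ => ∫ x, halfKernel (ε * Complex.I) x * g x) (𝓝[>] 0)
      (𝓝 (∫ x, halfKernel 0 x * g x)) := by
    refine tendsto_integral_filter_of_dominated_convergence (fun x => ‖g x‖) ?_ ?_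
      g.integrable.norm ?_
    · exact Eventually.of_forall fun ε => (aestronglyMeasurable_halfKernel _).mul
        g.continuous.aestronglyMeasurable
    · filter_upwards [h0] with ε hε
      refine Eventually.of_forall fun x => ?_
      rw [norm_mul]
      exact mul_le_of_le_one_left (norm_nonneg _)
        (norm_halfKernel_le_one (by simpa using hε.le) x)
    · refine Eventually.of_forall fun x => Tendsto.mul_const _ ?_
      have hc : Continuous fun ε : ℝ => halfKernel (ε * Complex.I) x := by
        have : Continuous fun z => halfKernel z x :=
          continuous_iff_continuousAt.2 fun z => (hasDerivAt_halfKernel z x).continuousAt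
        exact this.comp (by fun_prop)
      have := hc.tendsto 0
      simp only [Complex.ofReal_zero, zero_mul] at this
      exact this.mono_left nhdsWithin_le_nhds
  refine h1.congr' ?_
  filter_upwards [h0] with ε hε
  refine integral_congr_ae ?_
  filter_upwards [halfExp_ae hε] with x hx
  rw [hx]

/-- `K (P_0 1) = u(0) 1_{x > 0} + h`, where `F h (z) = (θ(z) - u(0)) i / z`. -/
theorem exists_isExtK_Pone {u : ℝ → ℂ} {θ : ℂ → ℂ} (hu : IsUnimodular u) (hHol : HolderAtZero u)
    (hθ : IsInner θ) (huθ : IsBoundaryValue u θ) :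
    ∃ (u₀ : ℂ) (h : L2), SuppNonneg h ∧
      (∀ z ∈ Cplus, laplace h z = (θ z - u₀) * (Complex.I / z)) ∧
      ((𝓕 h : L2) =ᵐ[volume]
        fun ξ => (u (-(2 * Real.pi) * ξ) - u₀) * (Complex.I / linePt 0 ξ)) ∧
      IsExtK hu (Pone 0) fun x => u₀ * halfKernel 0 x + h x := by
  obtain ⟨u₀, -, α, hα, -, C, δ, hδ, hC⟩ := hHol
  obtain ⟨b, hb, hbound⟩ := exists_holder_bound hu hα hδ hC
  have h0 : ∀ᶠ ε : ℝ in 𝓝[>] 0, 0 < ε := self_mem_nhdsWithin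
  have hq := quasiMeasurePreserving_mul (c := -(2 * Real.pi)) (by simp [Real.pi_ne_zero])
  have hmem : MemLp (fun ξ => (u (-(2 * Real.pi) * ξ) - u₀) * (Complex.I / linePt 0 ξ)) 2
      volume := by
    refine hb.mono' ?_ (hbound.mono fun ξ h => h 0)
    refine ((hu.aestronglyMeasurable.comp_quasiMeasurePreserving hq).sub
      aestronglyMeasurable_const).mul ?_
    exact ((continuous_linePt 0).measurable.const_div _).aestronglyMeasurable
  set h : L2 := 𝓕⁻ (hmem.toLp _) with hh
  have hF : (𝓕 h : L2) =ᵐ[volume]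
      fun ξ => (u (-(2 * Real.pi) * ξ) - u₀) * (Complex.I / linePt 0 ξ) := by
    rw [hh, FourierTransform.fourier_fourierInv_eq]
    exact hmem.coeFn_toLp
  have hK : ∀ ε : ℝ, 0 < ε → SuppNonneg (K hu (conjRefl (halfExp ε))) ∧
      ∀ z ∈ Cplus, laplace (K hu (conjRefl (halfExp ε))) z = θ z * laplace (halfExp ε) z := by
    intro ε hε
    have := K_of_suppNonneg_conjRefl hu hθ huθ (f := conjRefl (halfExp ε))
      (by rw [conjRefl_conjRefl]; exact suppNonneg_halfExp hε)
    rwa [conjRefl_conjRefl] at this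
  -- The subtracted term carries the whole singularity at 0; the remainder converges in L².
  set r : ℝ → L2 := fun ε => K hu (conjRefl (halfExp ε)) - u₀ • halfExp ε with hr
  have hrF : ∀ ε : ℝ, 0 < ε → (𝓕 (r ε) : L2) =ᵐ[volume]
      fun ξ => (u (-(2 * Real.pi) * ξ) - u₀) * (Complex.I / linePt ε ξ) := by
    intro ε hε
    filter_upwards [fourier_sub_smul_ae (K hu (conjRefl (halfExp ε))) (halfExp ε) u₀,
      fourier_K_ae hu (conjRefl (halfExp ε)), fourier_conjRefl (halfExp ε),
      fourier_halfExp hε] with ξ h1 h2 h3 h4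
    rw [hr, h1, h2, h3, h4, Complex.conj_conj]
    ring
  have hlimF : Tendsto (fun ε => (𝓕 (r ε) : L2)) (𝓝[>] 0) (𝓝 (𝓕 h)) := by
    refine tendsto_L2_of_dominated hb (h0.mono hrF)
      (Eventually.of_forall fun ε => hbound.mono fun ξ h => h ε) ?_ ?_
    · filter_upwards [hF, hbound] with ξ h1 h2
      rw [h1]
      exact h2 0
    · filter_upwards [hF, (volume : Measure ℝ).ae_ne 0] with ξ h1 hξ
      rw [h1]
      have hne : linePt 0 ξ ≠ 0 := by simp [linePt, Real.pi_ne_zero, hξ]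
      have hc : ContinuousAt (fun ε : ℝ =>
          (u (-(2 * Real.pi) * ξ) - u₀) * (Complex.I / linePt ε ξ)) 0 := by
        refine continuousAt_const.mul (continuousAt_const.div ?_ hne)
        unfold linePt
        fun_prop
      exact hc.tendsto.mono_left nhdsWithin_le_nhds
  have hlim : Tendsto r (𝓝[>] 0) (𝓝 h) := by
    have := ((FourierTransform.continuous_fourierInv (E := L2)).tendsto _).comp hlimF
    simpa [Function.comp_def, FourierTransform.fourierInv_fourier_eq] using this
  have hrs : ∀ᶠ ε : ℝ in 𝓝[>] 0, SuppNonneg (r ε) :=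
    h0.mono fun ε hε => (hK ε hε).1.sub_smul (suppNonneg_halfExp hε) u₀
  have hs : SuppNonneg h := suppNonneg_of_tendsto hlim hrs
  refine ⟨u₀, h, hs, fun z hz => ?_, hF, fun g => ?_, fun ε => conjRefl (halfExp ε),
    fun ε hε => conjRefl_halfExp_ae hε, fun g => ?_⟩
  · have hz' : 0 < z.im := hz
    -- The Fourier integral at z is continuous in L², so it can be computed from the explicit values
    -- for ε > 0.
    refine tendsto_nhds_unique (tendsto_laplace hlim hrs hs hz') ?_
    have hc : ContinuousAt (fun ε : ℝ =>
        (θ z - u₀) * (Complex.I / (z + ε * Complex.I))) 0 := by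
      refine continuousAt_const.mul (continuousAt_const.div (by fun_prop) ?_)
      rintro h
      rw [Complex.ofReal_zero, zero_mul, add_zero] at h
      simp [h] at hz'
    have h1 := hc.tendsto.mono_left (nhdsWithin_le_nhds (s := Ioi 0))
    simp only [Complex.ofReal_zero, zero_mul, add_zero] at h1
    refine h1.congr' ?_
    filter_upwards [h0] with ε hε
    rw [(hK ε hε).1.laplace_sub_smul (suppNonneg_halfExp hε) u₀ hz', (hK ε hε).2 z hz,
      laplace_halfExp hε hz']
    ring
  · simp only [add_mul, mul_assoc]
    exact ((integrable_halfKernel_zero_mul g).const_mul u₀).add (integrable_mul_schwartz h g)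
  · have h1 : ∀ ε : ℝ, ∫ x, K hu (conjRefl (halfExp ε)) x * g x =
        (∫ x, r ε x * g x) + u₀ * ∫ x, halfExp ε x * g x := by
      intro ε
      rw [← integral_const_mul, ← integral_add (integrable_mul_schwartz (r ε) g)
        ((integrable_mul_schwartz (halfExp ε) g).const_mul u₀)]
      refine integral_congr_ae ?_
      filter_upwards [Lp.coeFn_sub (K hu (conjRefl (halfExp ε))) (u₀ • halfExp ε),
        Lp.coeFn_smul u₀ (halfExp ε)] with x h3 h4
      rw [hr, h3, Pi.sub_apply, h4, Pi.smul_apply, smul_eq_mul]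
      ring
    have h2 : ∫ x, (u₀ * halfKernel 0 x + h x) * g x =
        (∫ x, h x * g x) + u₀ * ∫ x, halfKernel 0 x * g x := by
      rw [← integral_const_mul, ← integral_add (integrable_mul_schwartz h g)
        ((integrable_halfKernel_zero_mul g).const_mul u₀)]
      congr 1
      ext x
      ring
    simp only [h1, h2]
    exact (tendsto_integral_mul hlim (g.memLp 2 volume)).add
      ((tendsto_integral_halfExp_mul g).const_mul u₀)

/-! ### Uniqueness of the extension of `K` -/

theorem locallyIntegrable_of_forall_schwartz {T : ℝ → ℂ}
    (h : ∀ g : 𝓢(ℝ, ℂ), Integrable fun x => T x * g x) : LocallyIntegrable T volume := by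
  intro x
  let b : ContDiffBump x := ⟨1, 2, one_pos, one_lt_two⟩
  have hc : HasCompactSupport fun y => (b y : ℂ) :=
    b.hasCompactSupport.comp_left (g := Complex.ofReal) (by simp)
  have hi := h (hc.toSchwartzMap (Complex.ofRealCLM.contDiff.comp b.contDiff))
  refine ⟨Metric.closedBall x 1, Metric.closedBall_mem_nhds x one_pos, ?_⟩
  refine (hi.integrableOn (s := Metric.closedBall x 1)).congr_fun (fun y hy => ?_)
    measurableSet_closedBall
  have h1 : (b y : ℝ) = 1 := b.one_of_mem_closedBall hy
  have h2 : (hc.toSchwartzMap (Complex.ofRealCLM.contDiff.comp b.contDiff)) y = (b y : ℂ) := rfl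
  simp only [h2, h1, Complex.ofReal_one, mul_one]

/-- The damped functions are determined a.e. by S, and a distributional limit is unique. Thus the
extension does not depend on the witnesses in `IsPhi` and `IsPsi`. -/
theorem IsExtK.ae_eq {u : ℝ → ℂ} {hu : IsUnimodular u} {S S' T T' : ℝ → ℂ}
    (hS : S =ᵐ[volume] S') (h : IsExtK hu S T) (h' : IsExtK hu S' T') : T =ᵐ[volume] T' := by
  obtain ⟨hT, s, hs, hlim⟩ := h
  obtain ⟨hT', s', hs', hlim'⟩ := h'
  refine ae_eq_of_forall_integral_schwartz (locallyIntegrable_of_forall_schwartz hT)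
    (locallyIntegrable_of_forall_schwartz hT') fun g => ?_
  refine tendsto_nhds_unique (hlim g) ((hlim' g).congr' ?_)
  filter_upwards [self_mem_nhdsWithin] with ε hε
  have : s' ε = s ε := by
    refine Lp.ext ?_
    filter_upwards [hs ε hε, hs' ε hε, hS] with x h1 h2 h3
    rw [h1, h2, h3]
  rw [this]

theorem IsExtK.congr {u : ℝ → ℂ} {hu : IsUnimodular u} {S S' T : ℝ → ℂ}
    (hS : S =ᵐ[volume] S') (h : IsExtK hu S T) : IsExtK hu S' T := by
  obtain ⟨hT, s, hs, hlim⟩ := h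
  refine ⟨hT, s, fun ε hε => ?_, hlim⟩
  filter_upwards [hs ε hε, hS] with x h1 h2
  rw [h1, h2]

/-! ### The functions `Φ(0, ·)` and `Ψ(0, ·)` -/

theorem ae_coeFn_zero : ((0 : L2) : ℝ → ℂ) =ᵐ[volume] fun _ => 0 :=
  Lp.coeFn_zero ℂ 2 (volume : Measure ℝ)

section PhiPsi

variable {u : ℝ → ℂ} {θ : ℂ → ℂ} {hu : IsUnimodular u} {T : ℝ → ℂ}

/-- Since K(P₀1) vanishes on (-∞, 0), φ = 0 solves the equation. -/
theorem isPhi_of_isExtK (hT : IsExtK hu (Pone 0) T) (hT0 : ∀ᵐ x : ℝ, x < 0 → T x = 0) :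
    IsPhi hu 0 fun x => 1 - T x := by
  refine ⟨0, ae_coeFn_zero.mono fun x hx _ => hx, ⟨T, hT, ?_⟩, T, hT.congr ?_,
    Eventually.of_forall fun x => rfl⟩
  · rw [K_zero]
    filter_upwards [ae_coeFn_zero, hT0] with x h1 h2 hx
    rw [h1, h2 hx, add_zero, neg_zero]
  · filter_upwards [ae_coeFn_zero] with x hx
    rw [hx, zero_add]

theorem isPsi_of_isExtK (hT : IsExtK hu (Pone 0) T) (hT0 : ∀ᵐ x : ℝ, x < 0 → T x = 0) :
    IsPsi hu 0 fun x => 1 + T x := by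
  refine ⟨0, ae_coeFn_zero.mono fun x hx _ => hx, ⟨T, hT, ?_⟩, T, hT.congr ?_,
    Eventually.of_forall fun x => rfl⟩
  · rw [K_zero]
    filter_upwards [ae_coeFn_zero, hT0] with x h1 h2 hx
    rw [h1, h2 hx, sub_zero]
  · filter_upwards [ae_coeFn_zero] with x hx
    rw [hx, zero_add]

theorem K_eq_zero_of_suppNonpos (hθ : IsInner θ) (huθ : IsBoundaryValue u θ) {f : L2}
    (hf : ∀ᵐ x : ℝ, 0 < x → f x = 0) : ∀ᵐ x : ℝ, x < 0 → K hu f x = 0 :=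
  (K_of_suppNonneg_conjRefl hu hθ huθ ((suppNonneg_conjRefl_iff f).2 hf)).1

/-- On (-∞, 0) both K φ and K(P₀1) vanish, so the equation forces φ = 0. The coefficient -1 is left
explicit so that Φ and Ψ share the form 1 + c·T. -/
theorem IsPhi.ae_eq (hθ : IsInner θ) (huθ : IsBoundaryValue u θ) (hT : IsExtK hu (Pone 0) T)
    (hT0 : ∀ᵐ x : ℝ, x < 0 → T x = 0) {Φ : ℝ → ℂ} (h : IsPhi hu 0 Φ) :
    Φ =ᵐ[volume] fun x => 1 + (-1) * T x := by
  obtain ⟨φ, hφ, ⟨κ, hκ, hφκ⟩, S, hS, hΦ⟩ := h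
  have h0 : φ =ᵐ[volume] fun _ => 0 := by
    filter_upwards [hφ, hφκ, hκ.ae_eq EventuallyEq.rfl hT, hT0,
      K_eq_zero_of_suppNonpos (hu := hu) hθ huθ hφ, (volume : Measure ℝ).ae_ne 0] with x h1 h2 h3 h4 h5 h6
    rcases lt_or_gt_of_ne h6 with hx | hx
    · simpa [h3, h4 hx, h5 hx] using h2 hx
    · exact h1 hx
  have h1 : (fun x => φ x + Pone 0 x) =ᵐ[volume] Pone 0 := by
    filter_upwards [h0] with x hx
    rw [hx, zero_add]
  filter_upwards [hΦ, hS.ae_eq h1 hT] with x h2 h3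
  rw [h2, h3]
  ring

theorem IsPsi.ae_eq (hθ : IsInner θ) (huθ : IsBoundaryValue u θ) (hT : IsExtK hu (Pone 0) T)
    (hT0 : ∀ᵐ x : ℝ, x < 0 → T x = 0) {Ψ : ℝ → ℂ} (h : IsPsi hu 0 Ψ) :
    Ψ =ᵐ[volume] fun x => 1 + 1 * T x := by
  obtain ⟨ψ, hψ, ⟨κ, hκ, hψκ⟩, S, hS, hΨ⟩ := h
  have h0 : ψ =ᵐ[volume] fun _ => 0 := by
    filter_upwards [hψ, hψκ, hκ.ae_eq EventuallyEq.rfl hT, hT0,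
      K_eq_zero_of_suppNonpos (hu := hu) hθ huθ hψ, (volume : Measure ℝ).ae_ne 0] with x h1 h2 h3 h4 h5 h6
    rcases lt_or_gt_of_ne h6 with hx | hx
    · simpa [h3, h4 hx, h5 hx] using h2 hx
    · exact h1 hx
  have h1 : (fun x => ψ x + Pone 0 x) =ᵐ[volume] Pone 0 := by
    filter_upwards [h0] with x hx
    rw [hx, zero_add]
  filter_upwards [hΨ, hS.ae_eq h1 hT] with x h2 h3
  rw [h2, h3]
  ring

end PhiPsi

/-! ### The half-line Fourier transforms -/

section HalfLine

variable {X : ℝ → ℂ} {u₀ c : ℂ} {h : L2}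

theorem halfKernel_zero_of_pos {x : ℝ} (hx : 0 < x) : halfKernel 0 x = 1 := by
  simp [halfKernel, hx]

theorem indicator_mul_exp_ae
    (hX : X =ᵐ[volume] fun x => 1 + c * (u₀ * halfKernel 0 x + h x)) (z : ℂ) :
    (Ioi 0).indicator (fun x : ℝ => X x * Complex.exp (Complex.I * z * x)) =ᵐ[volume]
      fun x => (1 + c * u₀) * halfKernel z x + c * (h x * halfKernel z x) := by
  filter_upwards [hX] with x hx
  by_cases h0 : x ∈ Ioi (0 : ℝ)
  · have hz : halfKernel z x = Complex.exp (Complex.I * z * x) := indicator_of_mem h0 _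
    rw [indicator_of_mem h0, hx, halfKernel_zero_of_pos h0, hz]
    ring
  · have hz : halfKernel z x = 0 := indicator_of_notMem h0 _
    rw [indicator_of_notMem h0, hz]
    ring

theorem integrableOn_mul_exp
    (hX : X =ᵐ[volume] fun x => 1 + c * (u₀ * halfKernel 0 x + h x)) {z : ℂ} (hz : 0 < z.im) :
    IntegrableOn (fun x : ℝ => X x * Complex.exp (Complex.I * z * x)) (Ioi 0) := by
  rw [← integrable_indicator_iff measurableSet_Ioi]
  refine Integrable.congr ?_ (indicator_mul_exp_ae hX z).symm
  exact ((integrable_halfKernel hz).const_mul _).add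
    (((Lp.memLp h).integrable_mul (memLp_halfKernel hz)).const_mul c)

/-- The integral is (1 + c·u₀)·i/z + c·(θ - u₀)·i/z = (1 + c·θ)·i/z: the value u₀ cancels, and so
does z against the prefactor. -/
theorem halfHol_eq (hX : X =ᵐ[volume] fun x => 1 + c * (u₀ * halfKernel 0 x + h x))
    (hs : SuppNonneg h) {θ : ℂ → ℂ}
    (hh : ∀ z ∈ Cplus, laplace h z = (θ z - u₀) * (Complex.I / z)) {z : ℂ} (hz : 0 < z.im) :
    halfHol X 0 z = (1 + c * θ z) / 2 := by
  have hz0 : z ≠ 0 := by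
    rintro rfl
    simp at hz
  have h1 := hh z hz
  rw [hs.laplace_eq] at h1
  have hi : Integrable fun x => h x * halfKernel z x :=
    (Lp.memLp h).integrable_mul (memLp_halfKernel hz)
  rw [halfHol, ← integral_indicator measurableSet_Ioi,
    integral_congr_ae (indicator_mul_exp_ae hX z),
    integral_add ((integrable_halfKernel hz).const_mul _) (hi.const_mul c),
    integral_const_mul, integral_const_mul, integral_halfKernel hz, h1]
  field_simp
  linear_combination (-(1 + c * θ z)) * Complex.I_sq

/-- `g(-2πξ)` as a Schwartz function of `ξ`. -/
def scaleSchwartz (g : 𝓢(ℝ, ℂ)) : 𝓢(ℝ, ℂ) :=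
  SchwartzMap.compCLMOfContinuousLinearEquiv ℂ
    (ContinuousLinearEquiv.unitsEquivAut ℝ
      (Units.mk0 (-(2 * Real.pi)) (by simp [Real.pi_ne_zero]))) g

theorem scaleSchwartz_apply (g : 𝓢(ℝ, ℂ)) (ξ : ℝ) :
    scaleSchwartz g ξ = g (-(2 * Real.pi) * ξ) := by
  simp [scaleSchwartz, mul_comm]

/-- `-2πiξ g(-2πξ)` as a Schwartz function of `ξ`. -/
def scaleMulSchwartz (g : 𝓢(ℝ, ℂ)) : 𝓢(ℝ, ℂ) :=
  SchwartzMap.smulLeftCLM ℂ (fun ξ : ℝ => -2 * Real.pi * Complex.I * (ξ : ℂ)) (scaleSchwartz g)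

theorem scaleMulSchwartz_apply (g : 𝓢(ℝ, ℂ)) (ξ : ℝ) :
    scaleMulSchwartz g ξ = -2 * Real.pi * Complex.I * ξ * g (-(2 * Real.pi) * ξ) := by
  rw [scaleMulSchwartz, SchwartzMap.smulLeftCLM_apply_apply (by fun_prop), scaleSchwartz_apply,
    smul_eq_mul]

theorem integral_comp_neg_two_pi_mul (f : ℝ → ℂ) :
    ∫ ξ, f (-(2 * Real.pi) * ξ) = (2 * Real.pi : ℂ)⁻¹ * ∫ x, f x := by
  rw [Measure.integral_comp_mul_left, inv_neg, abs_neg, abs_of_pos (by positivity),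
    Complex.real_smul]
  push_cast
  rfl

/-- Substitute z = -2πξ. The multiplier is arranged as -2πiξ, the one that corresponds to
differentiating a Fourier transform. -/
theorem integral_test_eq (g : 𝓢(ℝ, ℂ)) (x : ℝ) :
    ∫ z : ℝ, (-(Complex.I * z / 2) * g z) * Complex.exp (Complex.I * z * x) =
      -Real.pi * (𝓕 (scaleMulSchwartz g) : 𝓢(ℝ, ℂ)) x := by
  have h1 := integral_comp_neg_two_pi_mul
    fun z : ℝ => (-(Complex.I * z / 2) * g z) * Complex.exp (Complex.I * z * x)
  have hpi : (Real.pi : ℂ) ≠ 0 := by exact_mod_cast Real.pi_ne_zero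
  have h2 : ∫ z : ℝ, (-(Complex.I * z / 2) * g z) * Complex.exp (Complex.I * z * x) =
      2 * Real.pi * ∫ ξ : ℝ, (-(Complex.I * ((-(2 * Real.pi) * ξ : ℝ) : ℂ) / 2) *
        g (-(2 * Real.pi) * ξ)) *
        Complex.exp (Complex.I * ((-(2 * Real.pi) * ξ : ℝ) : ℂ) * x) := by
    rw [h1, mul_inv_cancel_left₀ (mul_ne_zero two_ne_zero hpi)]
  rw [h2, SchwartzMap.fourier_coe, fourier_eq_integral_exp, ← integral_const_mul,
    ← integral_const_mul]
  refine integral_congr_ae (Eventually.of_forall fun ξ => ?_)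
  simp only [scaleMulSchwartz_apply]
  have : Complex.exp (Complex.I * ((-(2 * Real.pi) * ξ : ℝ) : ℂ) * x) =
    Complex.exp (Complex.I * ((-(2 * Real.pi) * x : ℝ) : ℂ) * ξ) := by
    congr 1
    push_cast
    ring
  rw [this]
  push_cast
  ring

/-- The integrand is the derivative of the transform of `scaleSchwartz g`, which vanishes at
infinity; the integral is minus its value at 0. -/
theorem integral_Ioi_fourier_scaleMulSchwartz (g : 𝓢(ℝ, ℂ)) :
    ∫ x in Ioi 0, (𝓕 (scaleMulSchwartz g) : 𝓢(ℝ, ℂ)) x = -((2 * Real.pi : ℂ)⁻¹ * ∫ x, g x) := by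
  have hd : ∀ x, HasDerivAt (𝓕 (scaleSchwartz g) : 𝓢(ℝ, ℂ))
      ((𝓕 (scaleMulSchwartz g) : 𝓢(ℝ, ℂ)) x) x := by
    intro x
    have hint : Integrable fun x : ℝ => x • scaleSchwartz g x := by
      have := (SchwartzMap.smulLeftCLM ℂ (fun ξ : ℝ => (ξ : ℂ)) (scaleSchwartz g)).integrable
        (μ := volume)
      refine this.congr (Eventually.of_forall fun ξ => ?_)
      simp only [SchwartzMap.smulLeftCLM_apply_apply (g := fun ξ : ℝ => (ξ : ℂ)) (by fun_prop)]
      simp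
    have := Real.hasDerivAt_fourier (scaleSchwartz g).integrable hint x
    rw [SchwartzMap.fourier_coe, SchwartzMap.fourier_coe]
    refine this.congr_deriv ?_
    refine congrArg (fun f : ℝ → ℂ => 𝓕 f x) (funext fun ξ => ?_)
    rw [scaleMulSchwartz_apply, scaleSchwartz_apply, smul_eq_mul]
  have hlim : Tendsto (𝓕 (scaleSchwartz g) : 𝓢(ℝ, ℂ)) atTop (𝓝 0) :=
    (SchwartzMap.tendsto_cocompact _).mono_left atTop_le_cocompact
  rw [integral_Ioi_of_hasDerivAt_of_tendsto' (fun x _ => hd x)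
    (SchwartzMap.integrable _).integrableOn hlim, zero_sub, SchwartzMap.fourier_coe,
    fourier_eq_integral_exp, ← integral_comp_neg_two_pi_mul]
  congr 1
  refine integral_congr_ae (Eventually.of_forall fun ξ => ?_)
  simp [scaleSchwartz_apply]

theorem halfDist_eq (hX : X =ᵐ[volume] fun x => 1 + c * (u₀ * halfKernel 0 x + h x))
    (hs : SuppNonneg h) {u : ℝ → ℂ} (hu : IsUnimodular u)
    (hF : (𝓕 h : L2) =ᵐ[volume]
      fun ξ => (u (-(2 * Real.pi) * ξ) - u₀) * (Complex.I / linePt 0 ξ)) (g : 𝓢(ℝ, ℂ)) :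
    halfDist X 0 g = ∫ x : ℝ, (1 + c * u x) / 2 * g x := by
  have hpi : (Real.pi : ℂ) ≠ 0 := by exact_mod_cast Real.pi_ne_zero
  set m : 𝓢(ℝ, ℂ) := 𝓕 (scaleMulSchwartz g) with hm
  have hug : Integrable fun x => u x * g x := by
    refine g.integrable.mono (hu.aestronglyMeasurable.mul g.continuous.aestronglyMeasurable) ?_
    filter_upwards [hu.norm_eq_one] with x hx
    rw [norm_mul, hx, one_mul]
  have h1 : halfDist X 0 g = -Real.pi * ∫ x in Ioi 0, X x * m x := by
    rw [halfDist, ← integral_const_mul]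
    congr 1
    ext x
    rw [integral_test_eq]
    ring
  have h2 : (Ioi 0).indicator (fun x => X x * m x) =ᵐ[volume]
      fun x => (1 + c * u₀) * (Ioi 0).indicator m x + c * (h x * m x) := by
    filter_upwards [hX, hs, (volume : Measure ℝ).ae_ne 0] with x e1 e2 e3
    rcases lt_or_gt_of_ne e3 with hx | hx
    · rw [indicator_of_notMem (by simpa using hx.le), indicator_of_notMem (by simpa using hx.le),
        e2 hx]
      ring
    · rw [indicator_of_mem (by simpa using hx), indicator_of_mem (by simpa using hx), e1,
        halfKernel_zero_of_pos hx]
      ring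
  -- Moving the Fourier transform onto `h`, the factor ξ in `scaleMulSchwartz` cancels the pole of
  -- the transform of `h`.
  have h3 : ∫ x, h x * m x = -((2 * Real.pi : ℂ)⁻¹ * ∫ x, (u x - u₀) * g x) := by
    rw [hm, ← integral_fourier_mul_schwartz, ← integral_comp_neg_two_pi_mul, ← integral_neg]
    refine integral_congr_ae ?_
    filter_upwards [hF, (volume : Measure ℝ).ae_ne 0] with ξ e1 e2
    have e2' : (ξ : ℂ) ≠ 0 := by exact_mod_cast e2
    rw [e1, scaleMulSchwartz_apply, linePt]
    push_cast
    rw [zero_mul, add_zero]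
    field_simp
    linear_combination ((u (-(2 * Real.pi * ξ)) - u₀) * g (-(2 * Real.pi * ξ))) * Complex.I_sq
  rw [h1, ← integral_indicator measurableSet_Ioi, integral_congr_ae h2, integral_add
    ((m.integrable.indicator measurableSet_Ioi).const_mul _)
    ((integrable_mul_schwartz h m).const_mul c), integral_const_mul, integral_const_mul,
    integral_indicator measurableSet_Ioi, integral_Ioi_fourier_scaleMulSchwartz, h3]
  have h4 : ∫ x, (u x - u₀) * g x = (∫ x, u x * g x) - u₀ * ∫ x, g x := by
    rw [← integral_const_mul, ← integral_sub hug (g.integrable.const_mul u₀)]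
    congr 1
    ext x
    ring
  have h5 : ∫ x, (1 + c * u x) / 2 * g x = 1 / 2 * (∫ x, g x) + c / 2 * ∫ x, u x * g x := by
    rw [← integral_const_mul, ← integral_const_mul,
      ← integral_add (g.integrable.const_mul _) (hug.const_mul _)]
    congr 1
    ext x
    ring
  rw [h4, h5]
  field_simp
  ring

end HalfLine

end LacunaryModel

end

/-! ### Proof of the theorem -/

open LacunaryModel in
theorem theorem2p5 (u : ℝ → ℂ) (hu : LacunaryModel.MemU1loc u)
    (θ : ℂ → ℂ) (hθ : LacunaryModel.IsInner θ) (huθ : LacunaryModel.IsBoundaryValue u θ) :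
    LacunaryModel.NormCompressionLtOne hu.toIsUnimodular 0 ∧
    (∃ Φ : ℝ → ℂ, LacunaryModel.IsPhi hu.toIsUnimodular 0 Φ) ∧
    (∃ Ψ : ℝ → ℂ, LacunaryModel.IsPsi hu.toIsUnimodular 0 Ψ) ∧
    (∀ Φ Ψ : ℝ → ℂ, LacunaryModel.IsPhi hu.toIsUnimodular 0 Φ →
      LacunaryModel.IsPsi hu.toIsUnimodular 0 Ψ →
      (∀ z ∈ LacunaryModel.Cplus,
        MeasureTheory.IntegrableOn (fun x : ℝ => Φ x * Complex.exp (Complex.I * z * x))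
          (Set.Ioi 0) ∧
        MeasureTheory.IntegrableOn (fun x : ℝ => Ψ x * Complex.exp (Complex.I * z * x))
          (Set.Ioi 0)) ∧
      (∀ z : ℂ, (0 < z.im ∨ z.im < 0 ∧ θ (conj z) ≠ 0) →
        LacunaryModel.Atilde (LacunaryModel.innerExt θ) Ψ 0 z =
          (1 + LacunaryModel.innerExt θ z) / 2 ∧
        -Complex.I * LacunaryModel.Btilde (LacunaryModel.innerExt θ) Φ 0 z =
          (1 - LacunaryModel.innerExt θ z) / 2) ∧
      (∀ g : 𝓢(ℝ, ℂ),
        LacunaryModel.AtildeDist Ψ 0 g = ∫ x : ℝ, (1 + u x) / 2 * g x ∧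
        -Complex.I * LacunaryModel.BtildeDist Φ 0 g = ∫ x : ℝ, (1 - u x) / 2 * g x)) ∧
    LacunaryModel.fourierV hu.toIsUnimodular 0 = LacunaryModel.modelSpace θ := by
  obtain ⟨u₀, h, hs, hh, hF, hT⟩ := exists_isExtK_Pone hu.toIsUnimodular hu.holder hθ huθ
  have hT0 : ∀ᵐ x : ℝ, x < 0 → u₀ * halfKernel 0 x + h x = 0 := by
    filter_upwards [hs] with x hx h0
    rw [hx h0, halfKernel, indicator_of_notMem (by simpa using h0.le), mul_zero, add_zero]
  refine ⟨normCompressionLtOne_zero _ hθ huθ, ⟨_, isPhi_of_isExtK hT hT0⟩,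
    ⟨_, isPsi_of_isExtK hT hT0⟩, fun Φ Ψ hΦ hΨ => ?_, fourierV_eq_modelSpace _ hθ huθ⟩
  have hΦ' := hΦ.ae_eq hθ huθ hT hT0
  have hΨ' := hΨ.ae_eq hθ huθ hT hT0
  refine ⟨fun z hz => ⟨integrableOn_mul_exp hΦ' hz, integrableOn_mul_exp hΨ' hz⟩, ?_, ?_⟩
  · rintro z (hz | ⟨hz, hθz⟩)
    · rw [Atilde, Btilde, continuation, continuation, innerExt, if_pos hz, if_pos hz, if_pos hz,
        halfHol_eq hΦ' hs hh hz, halfHol_eq hΨ' hs hh hz]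
      refine ⟨by ring, ?_⟩
      -- The prefactor -i cancels the factor i in the definition of B̃.
      linear_combination (-(1 - θ z) / 2) * Complex.I_sq
    · have hz' : 0 < (conj z).im := by simpa using hz
      have hne : conj (θ (conj z)) ≠ 0 := by simpa using hθz
      -- On ℂ₋ the extension of θ is 1/conj(θ(conj z)), finite by `hne`; multiplying it by the
      -- conjugate of (1 ± θ)/2 exchanges the two terms. For B̃ the conjugate of i supplies the
      -- missing sign.
      rw [Atilde, Btilde, continuation, continuation, innerExt, if_neg hz.not_gt,
        if_neg hz.not_gt, if_neg hz.not_gt,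
        halfHol_eq hΦ' hs hh hz', halfHol_eq hΨ' hs hh hz']
      simp only [map_mul, map_div₀, map_add, map_one, map_neg, Complex.conj_I, Complex.conj_ofNat]
      constructor
      · field_simp
        ring
      · field_simp
        linear_combination (1 - conj (θ (conj z))) * Complex.I_sq
  · intro g
    rw [AtildeDist, BtildeDist, halfDist_eq hΨ' hs hu.toIsUnimodular hF,
      halfDist_eq hΦ' hs hu.toIsUnimodular hF]
    refine ⟨by simp only [one_mul], ?_⟩
    rw [← mul_assoc, neg_mul, Complex.I_mul_I, neg_neg, one_mul]
    simp only [neg_one_mul, ← sub_eq_add_neg]
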